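/- Let $M$ be a smooth manifold of dimension $2n+1$ with an almost contact B-metric structure $(\varphi,\xi,\eta,g)$: $\varphi$ is a smooth endomorphism field of $TM$, $\xi$ a smooth vector field, $\eta$ a smooth $1$-form and $g$ a smooth pseudo-Riemannian metric of signature $(n+1,n)$ such that $$\varphi\xi=0,\quad \varphi^2=-\iota+\eta\otimes\xi,\quad \eta\circ\varphi=0,\quad \eta(\xi)=1,\quad g(\varphi x,\varphi y)=-g(x,y)+\eta(x)\eta(y),$$ where $\iota$ is the identity. Let $\nabla$ be the Levi-Civita connection of $g$, and suppose that the structure is Sasaki-like, i.e. $$(\nabla_x\varphi)y=-g(x,y)\xi-\eta(y)x+2\eta(x)\eta(y)\xi .$$ Let $R(x,y)z=\nabla_x\nabla_yz-\nabla_y\nabla_xz-\nabla_{[x,y]}z$ be the curvature tensor, $\rho(y,z)=\operatorname{tr}\bigl(x\mapsto R(x,y)z\bigr)$ the Ricci tensor, and $Q$ the Ricci operator, $g(Qy,z)=\rho(y,z)$. Then for all $x$ and $y$ $$(\nabla_xQ)\xi=Q\varphi x-2n\,\varphi x,\qquad (\nabla_\xi Q)y=2Q\varphi y .$$ -/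

import Mathlib

open Bundle FiberBundle
open scoped Manifold ContDiff

section SasakiLike

variable {E : Type*} [NormedAddCommGroup E] [NormedSpace ℝ E] [FiniteDimensional ℝ E]
  {H : Type*} [TopologicalSpace H] (I : ModelWithCorners ℝ E H)
  (M : Type*) [TopologicalSpace M] [ChartedSpace H M] [IsManifold I ∞ M]

/-- A smooth pseudo-Riemannian metric on `M`: a smooth field of nondegenerate symmetric bilinear
forms on the tangent spaces. -/
structure PseudoRiemannianMetric where
  val (p : M) : TangentSpace I p →L[ℝ] TangentSpace I p →L[ℝ] ℝ
  symm (p : M) (v w : TangentSpace I p) : val p v w = val p w v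
  nondegenerate (p : M) (v : TangentSpace I p) (hv : ∀ w, val p v w = 0) : v = 0
  contMDiff : ContMDiff I (I.prod 𝓘(ℝ, E →L[ℝ] E →L[ℝ] ℝ)) ∞
    (fun p ↦ TotalSpace.mk' (E →L[ℝ] E →L[ℝ] ℝ)
      (E := fun p : M ↦ TangentSpace I p →L[ℝ] TangentSpace I p →L[ℝ] ℝ) p (val p))

/-- An almost contact B-metric structure `(φ, ξ, η, g)` on `M`, where `dim M = 2n + 1`. -/
structure AlmostContactBMetric (n : ℕ) where
  φ (p : M) : TangentSpace I p →L[ℝ] TangentSpace I p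
  ξ (p : M) : TangentSpace I p
  η (p : M) : TangentSpace I p →L[ℝ] ℝ
  g : PseudoRiemannianMetric I M
  contMDiff_φ : ContMDiff I (I.prod 𝓘(ℝ, E →L[ℝ] E)) ∞
    (fun p ↦ TotalSpace.mk' (E →L[ℝ] E)
      (E := fun p : M ↦ TangentSpace I p →L[ℝ] TangentSpace I p) p (φ p))
  contMDiff_ξ : ContMDiff I (I.prod 𝓘(ℝ, E)) ∞
    (fun p ↦ TotalSpace.mk' E (E := fun p : M ↦ TangentSpace I p) p (ξ p))
  contMDiff_η : ContMDiff I (I.prod 𝓘(ℝ, E →L[ℝ] ℝ)) ∞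
    (fun p ↦ TotalSpace.mk' (E →L[ℝ] ℝ) (E := fun p : M ↦ TangentSpace I p →L[ℝ] ℝ) p (η p))
  /-- The metric has signature `(n + 1, n)`: every tangent space has a basis orthonormal for `g`
  with `n + 1` vectors of square `1` and `n` vectors of square `-1`. -/
  signature (p : M) : ∃ b : Module.Basis (Fin (n + 1) ⊕ Fin n) ℝ (TangentSpace I p),
    (∀ i j, i ≠ j → g.val p (b i) (b j) = 0) ∧
    (∀ i, g.val p (b (Sum.inl i)) (b (Sum.inl i)) = 1) ∧
    (∀ i, g.val p (b (Sum.inr i)) (b (Sum.inr i)) = -1)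
  φ_ξ (p : M) : φ p (ξ p) = 0
  φ_φ (p : M) (x : TangentSpace I p) : φ p (φ p x) = -x + η p x • ξ p
  η_φ (p : M) (x : TangentSpace I p) : η p (φ p x) = 0
  η_ξ (p : M) : η p (ξ p) = 1
  g_φ_φ (p : M) (x y : TangentSpace I p) :
    g.val p (φ p x) (φ p y) = -g.val p x y + η p x * η p y

variable {I M}

/-- `nabla` is the Levi-Civita connection of `g`: a smooth affine connection (it maps vector fields
that are smooth on an open set to smooth ones) that is torsion-free and compatible with `g`.
The application `nabla Y p x` stands for `(∇_x Y)(p)`. -/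
structure PseudoRiemannianMetric.IsLeviCivita (g : PseudoRiemannianMetric I M)
    (nabla : CovariantDerivative I E (fun p : M ↦ TangentSpace I p)) : Prop where
  smooth (U : Set M) (hU : IsOpen U) :
    ContMDiffCovariantDerivativeOn (F := E) ∞ nabla.toFun U
  torsion_free :
    nabla.torsion = 0
  metric (p : M) (x : TangentSpace I p) (Y Z : ∀ q : M, TangentSpace I q)
    (hY : MDiffAt (T% Y) p) (hZ : MDiffAt (T% Z) p) :
    mvfderiv I (fun q ↦ g.val q (Y q) (Z q)) p x =
      g.val p (nabla Y p x) (Z p) + g.val p (Y p) (nabla Z p x)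

/-- `R(X, Y)Z = ∇_X ∇_Y Z - ∇_Y ∇_X Z - ∇_[X, Y] Z` for vector fields `X`, `Y`, `Z`. -/
noncomputable def curvatureField
    (nabla : CovariantDerivative I E (fun p : M ↦ TangentSpace I p))
    (X Y Z : ∀ q : M, TangentSpace I q) (p : M) : TangentSpace I p :=
  nabla (fun q ↦ nabla Z q (Y q)) p (X p) - nabla (fun q ↦ nabla Z q (X q)) p (Y p)
    - nabla Z p (VectorField.mlieBracket I X Y p)

/-- The curvature tensor at a point: `R(x, y)z` for tangent vectors `x`, `y`, `z` at `p`, computed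
with vector fields extending them smoothly near `p` (the value does not depend on these). -/
noncomputable def curvature
    (nabla : CovariantDerivative I E (fun p : M ↦ TangentSpace I p)) (p : M)
    (x y z : TangentSpace I p) : TangentSpace I p :=
  curvatureField nabla (extend E x) (extend E y) (extend E z) p

/-- A basis of the tangent space at `p`. -/
noncomputable def tangentBasis (p : M) :
    Module.Basis (Fin (Module.finrank ℝ E)) ℝ (TangentSpace I p) :=
  Module.finBasis ℝ E

/-- The Ricci tensor `ρ(y, z) = trace (x ↦ R(x, y)z)`, which is `g^{ij} R(e_i, y, z, e_j)`. -/
noncomputable def ricci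
    (nabla : CovariantDerivative I E (fun p : M ↦ TangentSpace I p)) (p : M)
    (y z : TangentSpace I p) : ℝ :=
  ∑ i, (tangentBasis (I := I) p).coord i (curvature nabla p (tangentBasis (I := I) p i) y z)

/-- The metric at `p` as a bilinear form. -/
noncomputable def PseudoRiemannianMetric.bilin (g : PseudoRiemannianMetric I M) (p : M) :
    LinearMap.BilinForm ℝ (TangentSpace I p) :=
  LinearMap.mk₂ ℝ (fun v w ↦ g.val p v w) (by simp) (by simp) (by simp) (by simp)

theorem PseudoRiemannianMetric.bilin_nondegenerate (g : PseudoRiemannianMetric I M) (p : M) :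
    (g.bilin p).Nondegenerate :=
  ⟨fun v hv ↦ g.nondegenerate p v hv,
    fun v hv ↦ g.nondegenerate p v fun w ↦ (g.symm p v w).trans (hv w)⟩

/-- The Ricci operator `Q`, determined by `g(Qy, z) = ρ(y, z)`: it is `Q y = ∑ j, ρ(y, e_j) e^j`,
where `g(e^j, e_k)` is `1` for `j = k` and `0` otherwise. -/
noncomputable def ricciOperator (g : PseudoRiemannianMetric I M)
    (nabla : CovariantDerivative I E (fun p : M ↦ TangentSpace I p)) (p : M)
    (y : TangentSpace I p) : TangentSpace I p :=
  ∑ j, ricci nabla p y (tangentBasis (I := I) p j) •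
    (g.bilin p).dualBasis (g.bilin_nondegenerate p) (tangentBasis (I := I) p) j

theorem val_ricciOperator_basis (g : PseudoRiemannianMetric I M)
    (nabla : CovariantDerivative I E (fun p : M ↦ TangentSpace I p)) (p : M)
    (y : TangentSpace I p) (k : Fin (Module.finrank ℝ E)) :
    g.val p (ricciOperator g nabla p y) (tangentBasis (I := I) p k) =
      ricci nabla p y (tangentBasis (I := I) p k) := by
  have h (j) := (g.bilin p).apply_dualBasis_left (g.bilin_nondegenerate p)
    (tangentBasis (I := I) p) j k
  change ∀ j, g.val p _ _ = _ at h
  simp [ricciOperator, h]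

/-- The covariant derivative `(∇_x A)Y = ∇_x (A Y) - A (∇_x Y)` of a field `A` of endomorphisms of
the tangent spaces, for a tangent vector `x` at `p` and a vector field `Y`. -/
noncomputable def covDerivEndo
    (nabla : CovariantDerivative I E (fun p : M ↦ TangentSpace I p))
    (A : ∀ q : M, TangentSpace I q → TangentSpace I q)
    (Y : ∀ q : M, TangentSpace I q) (p : M) (x : TangentSpace I p) : TangentSpace I p :=
  nabla (fun q ↦ A q (Y q)) p x - A p (nabla Y p x)

/-- The vector field `Y` is smooth at `p`. -/
def SmoothVectorFieldAt (Y : ∀ q : M, TangentSpace I q) (p : M) : Prop :=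
  ContMDiffAt I (I.prod 𝓘(ℝ, E)) ∞
    (fun q ↦ TotalSpace.mk' E (E := fun q : M ↦ TangentSpace I q) q (Y q)) p

/-- The structure is Sasaki-like: `(∇_x φ)y = -g(x, y)ξ - η(y)x + 2η(x)η(y)ξ`, where `nabla` is
the Levi-Civita connection of its metric. -/
def AlmostContactBMetric.IsSasakiLike {n : ℕ} (S : AlmostContactBMetric I M n)
    (nabla : CovariantDerivative I E (fun p : M ↦ TangentSpace I p)) : Prop :=
  ∀ (p : M) (x : TangentSpace I p) (Y : ∀ q : M, TangentSpace I q), SmoothVectorFieldAt Y p →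
    covDerivEndo nabla (fun q v ↦ S.φ q v) Y p x =
      -S.g.val p x (Y p) • S.ξ p - S.η p (Y p) • x + (2 * S.η p x * S.η p (Y p)) • S.ξ p

end SasakiLike

/-!
The smooth functions on an open set `W` over which the tangent bundle is trivial form a ring `A`,
and the smooth vector fields on `W` a free `A`-module `V` of rank `dim M`. On `V` the argument is
pure algebra, carried out in `SasakiLikeAlgebra A V`: a torsion-free connection with parallel `g`
and the structure equations of `(φ, ξ, η, g)`.

The Sasaki-like condition gives `∇_X ξ = -φX`, hence `R(X, Y)ξ = η(Y)X - η(X)Y` and, by pair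
symmetry and a trace, `Qξ = (dim M - 1)ξ`. Differentiating this equation along `X` yields the
formula for `(∇_X Q)ξ`.

For `(∇_ξ Q)Y` two facts are combined.
* The Lie derivative of the connection along `ξ` is `2(g - η ⊗ η) ⊗ ξ` (`lie_ξ_cov`). The resulting
  Lie derivative of the curvature (`lie_ξ_curv`) has vanishing Ricci trace because `tr φ = 0`, so
  `ξ` preserves the Ricci tensor (`der_ξ_ric`). The trace of `φ` vanishes because `φ³ = -φ`
  (`LinearMap.trace_eq_zero_of_cube_eq_neg`).
* The Ricci operator commutes with `φ` (`ric_φ`): the commutator of `R(X, Y)` with `φ` is explicit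
  (`curv_φ`), and its trace expresses `ρ(Y, φZ)` as `tr (φ ∘ R(·, Y)Z)` plus terms symmetric in `Y`
  and `Z`; the former is symmetric too, by the pair symmetry of the curvature.

As `ξ` acts on vector fields by `L_ξ Y = ∇_ξ Y + φY`, invariance of `ρ` under `ξ` reads
`(∇_ξ ρ)(Y, Z) = ρ(φY, Z) + ρ(Y, φZ) = 2ρ(φY, Z)`.

The rest transports these identities to the manifold: the connection, the tensors, and finally
curvature and Ricci operator at a point are evaluations of their algebraic counterparts on `W`
(`localAlgebra`, `curvature_eq`, `ricciOperator_eq`). A vector field that is only smooth at one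
point, and perhaps not on any neighbourhood, is expanded in a smooth frame with coefficients that
are differentiable at that point.
-/

open scoped Topology

/-! ### Torsion-free connections in algebraic form -/

/-- A torsion-free connection in algebraic form. The commutative ring `A` plays the role of the
smooth functions on an open set and the `A`-module `V` that of the smooth vector fields there;
`der X f` stands for `X f` and `cov X Y` for `∇_X Y`. Vanishing of the torsion is built in: the
bracket of `X` and `Y` is `cov X Y - cov Y X`, and it acts on functions as the commutator and
satisfies the Jacobi identity. -/
structure TorsionFreeConnection (A V : Type*) [CommRing A] [AddCommGroup V] [Module A V] where
  der : V → A → A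
  cov : V → V → V
  der_add (X : V) (f h : A) : der X (f + h) = der X f + der X h
  der_mul (X : V) (f h : A) : der X (f * h) = f * der X h + h * der X f
  cov_add_left (X X' Y : V) : cov (X + X') Y = cov X Y + cov X' Y
  cov_smul_left (f : A) (X Y : V) : cov (f • X) Y = f • cov X Y
  cov_add (X Y Y' : V) : cov X (Y + Y') = cov X Y + cov X Y'
  cov_smul (X : V) (f : A) (Y : V) : cov X (f • Y) = f • cov X Y + der X f • Y
  der_bracket (X Y : V) (f : A) : der (cov X Y - cov Y X) f = der X (der Y f) - der Y (der X f)
  jacobi (X Y Z : V) :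
    cov X (cov Y Z - cov Z Y) - cov (cov Y Z - cov Z Y) X =
      (cov (cov X Y - cov Y X) Z - cov Z (cov X Y - cov Y X)) +
        (cov Y (cov X Z - cov Z X) - cov (cov X Z - cov Z X) Y)

namespace TorsionFreeConnection

variable {A V : Type*} [CommRing A] [AddCommGroup V] [Module A V] (C : TorsionFreeConnection A V)

lemma cov_neg_left (X Y : V) : C.cov (-X) Y = -C.cov X Y := by
  simpa using C.cov_smul_left (-1) X Y

lemma cov_sub_left (X X' Y : V) : C.cov (X - X') Y = C.cov X Y - C.cov X' Y := by
  rw [sub_eq_add_neg, cov_add_left, cov_neg_left, sub_eq_add_neg]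

lemma cov_zero (X : V) : C.cov X 0 = 0 := by
  simpa using C.cov_add X 0 0

lemma cov_neg (X Y : V) : C.cov X (-Y) = -C.cov X Y := by
  rw [eq_neg_iff_add_eq_zero, ← C.cov_add, neg_add_cancel, cov_zero]

lemma cov_sub (X Y Y' : V) : C.cov X (Y - Y') = C.cov X Y - C.cov X Y' := by
  rw [sub_eq_add_neg, cov_add, cov_neg, sub_eq_add_neg]

lemma der_zero (X : V) : C.der X 0 = 0 := by
  simpa using C.der_add X 0 0

lemma der_one (X : V) : C.der X 1 = 0 := by
  simpa using C.der_mul X 1 1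

lemma der_neg (X : V) (f : A) : C.der X (-f) = -C.der X f := by
  rw [eq_neg_iff_add_eq_zero, ← C.der_add, neg_add_cancel, der_zero]

lemma der_sub (X : V) (f h : A) : C.der X (f - h) = C.der X f - C.der X h := by
  rw [sub_eq_add_neg, der_add, der_neg, sub_eq_add_neg]

lemma der_two (X : V) : C.der X 2 = 0 := by
  rw [← one_add_one_eq_two, der_add, der_one, add_zero]

lemma der_sum {ι : Type*} (s : Finset ι) (X : V) (f : ι → A) :
    C.der X (∑ i ∈ s, f i) = ∑ i ∈ s, C.der X (f i) := by
  classical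
  induction s using Finset.induction_on with
  | empty => simp [der_zero]
  | insert a s ha h => simp [Finset.sum_insert ha, der_add, h]

/-- The bracket of two vector fields. -/
def lie (X Y : V) : V := C.cov X Y - C.cov Y X

/-- The curvature `R(X, Y)Z`. -/
def curv (X Y Z : V) : V := C.cov X (C.cov Y Z) - C.cov Y (C.cov X Z) - C.cov (C.lie X Y) Z

lemma lie_add (X Y Y' : V) : C.lie X (Y + Y') = C.lie X Y + C.lie X Y' := by
  simp only [lie, cov_add, cov_add_left]; abel

lemma lie_sub (X Y Y' : V) : C.lie X (Y - Y') = C.lie X Y - C.lie X Y' := by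
  simp only [lie, cov_sub, cov_sub_left]; abel

lemma lie_smul (X : V) (f : A) (Y : V) : C.lie X (f • Y) = f • C.lie X Y + C.der X f • Y := by
  simp only [lie, cov_smul, cov_smul_left]; module

lemma lie_sum {ι : Type*} (s : Finset ι) (X : V) (Y : ι → V) :
    C.lie X (∑ i ∈ s, Y i) = ∑ i ∈ s, C.lie X (Y i) := by
  classical
  induction s using Finset.induction_on with
  | empty => simpa using C.lie_sub X 0 0
  | insert a s ha h => simp [Finset.sum_insert ha, lie_add, h]

lemma curv_swap (X Y Z : V) : C.curv X Y Z = -C.curv Y X Z := by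
  simp only [curv, lie, cov_sub_left]; abel

lemma curv_add_left (X X' Y Z : V) : C.curv (X + X') Y Z = C.curv X Y Z + C.curv X' Y Z := by
  simp only [curv, lie, cov_add_left, cov_sub_left, cov_add]; abel

lemma curv_smul_left (f : A) (X Y Z : V) : C.curv (f • X) Y Z = f • C.curv X Y Z := by
  simp only [curv, lie, cov_smul_left, cov_sub_left, cov_smul, cov_add_left]; module

lemma curv_add_mid (X Y Y' Z : V) : C.curv X (Y + Y') Z = C.curv X Y Z + C.curv X Y' Z := by
  rw [curv_swap, curv_add_left, C.curv_swap X Y, C.curv_swap X Y']; abel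

lemma curv_smul_mid (f : A) (X Y Z : V) : C.curv X (f • Y) Z = f • C.curv X Y Z := by
  rw [curv_swap, curv_smul_left, C.curv_swap X Y]; module

lemma curv_add_right (X Y Z Z' : V) : C.curv X Y (Z + Z') = C.curv X Y Z + C.curv X Y Z' := by
  simp only [curv, cov_add]; abel

lemma curv_smul_right (f : A) (X Y Z : V) : C.curv X Y (f • Z) = f • C.curv X Y Z := by
  simp only [curv, cov_smul, cov_add]
  rw [show C.der (C.lie X Y) f = _ from C.der_bracket X Y f]
  module

lemma first_bianchi (X Y Z : V) : C.curv X Y Z + C.curv Y Z X + C.curv Z X Y = 0 := by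
  have h := C.jacobi X Y Z
  simp only [cov_sub, cov_sub_left] at h
  simp only [curv, lie, cov_sub_left]
  linear_combination (norm := module) h

/-- The endomorphism `X ↦ R(X, Y)Z`, whose trace is the Ricci tensor. -/
@[simps]
def curvEndo (Y Z : V) : V →ₗ[A] V where
  toFun X := C.curv X Y Z
  map_add' X X' := C.curv_add_left X X' Y Z
  map_smul' f X := C.curv_smul_left f X Y Z

/-- The Ricci tensor `ρ(Y, Z) = tr (X ↦ R(X, Y)Z)`. -/
noncomputable def ric (Y Z : V) : A := LinearMap.trace A V (C.curvEndo Y Z)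

lemma ric_add_left (Y Y' Z : V) : C.ric (Y + Y') Z = C.ric Y Z + C.ric Y' Z := by
  simp only [ric, ← map_add]
  congr 1; ext X; simp [curv_add_mid]

lemma ric_smul_left (f : A) (Y Z : V) : C.ric (f • Y) Z = f * C.ric Y Z := by
  simp only [ric, ← smul_eq_mul, ← map_smul]
  congr 1; ext X; simp [curv_smul_mid]

lemma ric_add_right (Y Z Z' : V) : C.ric Y (Z + Z') = C.ric Y Z + C.ric Y Z' := by
  simp only [ric, ← map_add]
  congr 1; ext X; simp [curv_add_right]

lemma ric_smul_right (f : A) (Y Z : V) : C.ric Y (f • Z) = f * C.ric Y Z := by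
  simp only [ric, ← smul_eq_mul, ← map_smul]
  congr 1; ext X; simp [curv_smul_right]

/-- The Lie derivative commutes with the trace: if `B'` is the Lie derivative of the endomorphism
`B` along `X`, then `X (tr B) = tr B'`. -/
lemma der_trace {ι : Type*} [Fintype ι] (b : Module.Basis ι A V) (X : V) (B B' : V →ₗ[A] V)
    (h : ∀ Y, B' Y = C.lie X (B Y) - B (C.lie X Y)) :
    C.der X (LinearMap.trace A V B) = LinearMap.trace A V B' := by
  classical
  have tr (T : V →ₗ[A] V) : LinearMap.trace A V T = ∑ i, b.repr (T (b i)) i := by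
    rw [LinearMap.trace_eq_matrix_trace A b, Matrix.trace]
    simp [LinearMap.toMatrix_apply]
  -- The two sums below are `∑ i, ∑ j, B i j * ω j i` with the roles of `i` and `j` exchanged,
  -- where `ω` is the matrix of `lie X` in the basis.
  have h₁ (i) : C.lie X (B (b i)) =
      ∑ j, (b.repr (B (b i)) j • C.lie X (b j) + C.der X (b.repr (B (b i)) j) • b j) := by
    conv_lhs => rw [← b.sum_repr (B (b i)), lie_sum]
    simp only [lie_smul]
  have h₂ (i) : B (C.lie X (b i)) = ∑ j, b.repr (C.lie X (b i)) j • B (b j) := by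
    conv_lhs => rw [← b.sum_repr (C.lie X (b i)), map_sum]
    simp only [map_smul]
  rw [tr, tr, der_sum]
  simp only [h, map_sub, Finsupp.sub_apply, Finset.sum_sub_distrib]
  simp only [h₁, h₂]
  simp only [map_sum, map_add, map_smul, Finsupp.coe_finsetSum, Finset.sum_apply,
    Finsupp.add_apply, Finsupp.smul_apply, smul_eq_mul, Module.Basis.repr_self,
    Finsupp.single_apply, mul_ite, mul_one, mul_zero, Finset.sum_add_distrib,
    Finset.sum_ite_eq', Finset.mem_univ, if_true]
  rw [Finset.sum_comm, add_sub_right_comm, eq_comm, add_eq_right, sub_eq_zero]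
  simp only [mul_comm]

end TorsionFreeConnection

/-! ### Sasaki-like structures in algebraic form -/

/-- A Sasaki-like almost contact B-metric structure in algebraic form: a torsion-free connection
together with `(φ, ξ, η, g)` satisfying the structure equations, such that `g` is parallel and
`(∇_X φ)Y = -g(X, Y)ξ - η(Y)X + 2η(X)η(Y)ξ`. Nondegeneracy of `g` is the bijectivity of the map
`V → V*`, which over a ring is stronger than injectivity. -/
structure SasakiLikeAlgebra (A V : Type*) [CommRing A] [AddCommGroup V] [Module A V] extends
    TorsionFreeConnection A V where
  g : V →ₗ[A] V →ₗ[A] A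
  φ : V →ₗ[A] V
  ξ : V
  η : V →ₗ[A] A
  g_symm (X Y : V) : g X Y = g Y X
  g_bijective : Function.Bijective g
  der_g (X Y Z : V) : der X (g Y Z) = g (cov X Y) Z + g Y (cov X Z)
  φ_ξ : φ ξ = 0
  φ_φ (X : V) : φ (φ X) = -X + η X • ξ
  η_φ (X : V) : η (φ X) = 0
  η_ξ : η ξ = 1
  g_φ_φ (X Y : V) : g (φ X) (φ Y) = -g X Y + η X * η Y
  cov_φ (X Y : V) : cov X (φ Y) - φ (cov X Y) =
    -g X Y • ξ - η Y • X + (2 * η X * η Y) • ξ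

namespace SasakiLikeAlgebra

variable {A V : Type*} [CommRing A] [AddCommGroup V] [Module A V] (C : SasakiLikeAlgebra A V)

/-! ### Symmetries of the curvature of a metric torsion-free connection -/

lemma eq_of_g_eq {X Y : V} (h : ∀ Z, C.g X Z = C.g Y Z) : X = Y :=
  C.g_bijective.1 (LinearMap.ext h)

lemma g_curv_skew (X Y Z W : V) : C.g (C.curv X Y Z) W = -C.g Z (C.curv X Y W) := by
  have h := C.der_bracket X Y (C.g Z W)
  simp only [C.der_g, C.der_add] at h
  simp only [TorsionFreeConnection.curv, TorsionFreeConnection.lie, map_sub, LinearMap.sub_apply]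
  linear_combination -h

lemma g_curv_pair [IsAddTorsionFree A] (X Y Z W : V) :
    C.g (C.curv X Y Z) W = C.g (C.curv Z W X) Y := by
  have b (X Y Z W : V) := congrArg (fun U ↦ C.g U W) (C.first_bianchi X Y Z)
  have s (X Y Z W : V) : C.g (C.curv X Y Z) W = -C.g (C.curv X Y W) Z := by
    rw [C.g_curv_skew, C.g_symm]
  have t (X Y Z W : V) : C.g (C.curv X Y Z) W = -C.g (C.curv Y X Z) W := by
    rw [C.curv_swap]; simp
  simp only [map_add, LinearMap.add_apply, map_zero, LinearMap.zero_apply] at b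
  have h : 2 • (C.g (C.curv X Y Z) W - C.g (C.curv Z W X) Y) = 0 := by
    -- Octahedron argument: a signed sum of four instances of the Bianchi identity
    rw [two_nsmul]
    linear_combination b X Y Z W + b Y Z W X - b Z W X Y - b W X Y Z
      - s Y Z X W - s Z W Y X + s X Y W Z + t X Z W Y - s Z X W Y - t W Y Z X + s Y W Z X
      + s W X Z Y
  rw [← sub_eq_zero]
  exact (nsmul_eq_zero_iff_right two_ne_zero).1 h

/-- Endomorphisms that are adjoint to each other for `g` have the same trace. -/
lemma trace_eq_of_adjoint [Module.Free A V] [Module.Finite A V] {T T' : V →ₗ[A] V}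
    (h : ∀ X Y, C.g (T X) Y = C.g X (T' Y)) : LinearMap.trace A V T = LinearMap.trace A V T' := by
  let e : V ≃ₗ[A] Module.Dual A V := LinearEquiv.ofBijective C.g C.g_bijective
  have he : Module.Dual.transpose (R := A) T = e.conj T' := by
    ext α X
    obtain ⟨Y, rfl⟩ := e.surjective α
    have e_apply (U W : V) : e U W = C.g U W := rfl
    simp [LinearEquiv.conj_apply, Module.Dual.transpose_apply, e_apply, C.g_symm Y, h, C.g_symm X]
  rw [← LinearMap.trace_transpose', he, LinearMap.trace_conj']

lemma ric_symm [IsAddTorsionFree A] [Module.Free A V] [Module.Finite A V] (Y Z : V) :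
    C.ric Y Z = C.ric Z Y :=
  C.trace_eq_of_adjoint fun X W ↦ by
    simp only [TorsionFreeConnection.curvEndo_apply]
    rw [C.g_curv_pair, C.curv_swap Z W, map_neg, LinearMap.neg_apply, C.g_curv_skew, neg_neg]

/-! ### The characteristic field of a Sasaki-like structure -/

lemma g_ξ (X : V) : C.g X C.ξ = C.η X := by
  have h := C.g_φ_φ X C.ξ
  rw [C.φ_ξ, C.η_ξ, map_zero] at h
  linear_combination h

lemma g_φ_left (X Y : V) : C.g (C.φ X) Y = C.g X (C.φ Y) := by
  have h := C.g_φ_φ X (C.φ Y)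
  rw [C.φ_φ, C.η_φ] at h
  simp only [map_add, map_neg, map_smul, C.g_ξ, C.η_φ] at h
  simp only [smul_eq_mul] at h
  linear_combination -h

/-- `∇_X ξ = -φX`: apply `φ` to the Sasaki-like condition for `Y = ξ`. -/
lemma cov_ξ [IsAddTorsionFree A] (X : V) : C.cov X C.ξ = -C.φ X := by
  have h₀ : C.η (C.cov X C.ξ) = 0 := by
    have h := C.der_g X C.ξ C.ξ
    rw [C.g_symm C.ξ (C.cov X C.ξ), C.g_ξ, C.g_ξ, C.η_ξ, C.der_one, ← two_nsmul] at h
    exact (nsmul_eq_zero_iff_right two_ne_zero).1 h.symm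
  have h := congrArg C.φ (C.cov_φ X C.ξ)
  simp only [map_sub, map_add, map_smul, C.φ_ξ, C.cov_zero, C.φ_φ, C.g_ξ, C.η_ξ, h₀, map_zero] at h
  linear_combination (norm := module) h

lemma der_η [IsAddTorsionFree A] (X Y : V) :
    C.der X (C.η Y) = C.η (C.cov X Y) - C.g (C.φ X) Y := by
  rw [← C.g_ξ, C.der_g, C.cov_ξ, C.g_ξ, map_neg, C.g_symm Y, sub_eq_add_neg]

lemma cov_φ' (X Y : V) : C.cov X (C.φ Y) = C.φ (C.cov X Y) +
    (-C.g X Y • C.ξ - C.η Y • X + (2 * C.η X * C.η Y) • C.ξ) := by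
  rw [← C.cov_φ]; abel

lemma curv_ξ [IsAddTorsionFree A] (X Y : V) : C.curv X Y C.ξ = C.η Y • X - C.η X • Y := by
  simp only [TorsionFreeConnection.curv, TorsionFreeConnection.lie, C.cov_ξ, C.cov_neg,
    C.cov_φ', map_sub, C.g_symm X Y]
  module

lemma curv_ξ_mid [IsAddTorsionFree A] (X Z : V) :
    C.curv X C.ξ Z = C.η Z • X - C.g X Z • C.ξ := by
  refine C.eq_of_g_eq fun W ↦ ?_
  rw [C.g_curv_pair, C.g_curv_skew, C.curv_ξ]
  simp only [map_sub, map_smul, LinearMap.sub_apply, LinearMap.smul_apply, smul_eq_mul,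
    C.g_symm C.ξ, C.g_ξ]
  ring

lemma curv_ξ_left [IsAddTorsionFree A] (X Z : V) :
    C.curv C.ξ X Z = C.g X Z • C.ξ - C.η Z • X := by
  rw [C.curv_swap, C.curv_ξ_mid]; abel

lemma lie_ξ [IsAddTorsionFree A] (Y : V) : C.lie C.ξ Y = C.cov C.ξ Y + C.φ Y := by
  simp only [TorsionFreeConnection.lie, C.cov_ξ]; abel

/-- The Lie derivative of the connection along `ξ` is `2(g - η ⊗ η) ⊗ ξ`. -/
lemma lie_ξ_cov [IsAddTorsionFree A] (X Y : V) :
    C.lie C.ξ (C.cov X Y) = C.cov X (C.lie C.ξ Y) + C.cov (C.lie C.ξ X) Y +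
      (2 * (C.g X Y - C.η X * C.η Y)) • C.ξ := by
  have h := C.curv_ξ_left X Y
  simp only [TorsionFreeConnection.curv] at h
  rw [C.lie_ξ (C.cov X Y), C.lie_ξ Y, C.cov_add, C.cov_φ']
  linear_combination (norm := module) h

/-- The Lie derivative of the curvature along `ξ`. -/
lemma lie_ξ_curv [IsAddTorsionFree A] (X Y Z : V) :
    C.lie C.ξ (C.curv X Y Z) =
      C.curv (C.lie C.ξ X) Y Z + C.curv X (C.lie C.ξ Y) Z + C.curv X Y (C.lie C.ξ Z) +
      (2 * (C.η Y * C.g (C.φ X) Z - C.η X * C.g (C.φ Y) Z)) • C.ξ -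
      (2 * (C.g Y Z - C.η Y * C.η Z)) • C.φ X + (2 * (C.g X Z - C.η X * C.η Z)) • C.φ Y := by
  have hjac : C.lie C.ξ (C.lie X Y) = C.lie (C.lie C.ξ X) Y + C.lie X (C.lie C.ξ Y) :=
    C.jacobi C.ξ X Y
  have hb : C.lie X Y = C.cov X Y - C.cov Y X := rfl
  have hs : C.g (C.φ Y) X = C.g (C.φ X) Y := by rw [C.g_φ_left, C.g_symm]
  simp only [TorsionFreeConnection.curv, C.lie_sub, C.lie_ξ_cov, hjac, C.cov_add, C.cov_add_left,
    C.cov_smul, C.der_mul, C.der_two, C.der_sub, C.der_g, C.der_η, C.cov_ξ]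
  simp only [hb, map_sub, LinearMap.sub_apply, hs]
  module

/-- The commutator of the curvature with `φ`. -/
lemma curv_φ [IsAddTorsionFree A] (X Y Z : V) :
    C.curv X Y (C.φ Z) - C.φ (C.curv X Y Z) =
      C.g Y Z • C.φ X - C.g X Z • C.φ Y + C.g (C.φ X) Z • Y - C.g (C.φ Y) Z • X -
      (2 * (C.η Y * C.g (C.φ X) Z - C.η X * C.g (C.φ Y) Z)) • C.ξ -
      (2 * C.η Z) • (C.η Y • C.φ X - C.η X • C.φ Y) := by
  have hb : C.lie X Y = C.cov X Y - C.cov Y X := rfl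
  have hs : C.g (C.φ Y) X = C.g (C.φ X) Y := by rw [C.g_φ_left, C.g_symm]
  simp only [TorsionFreeConnection.curv, C.cov_φ', C.cov_add, C.cov_neg, neg_smul, C.cov_sub,
    C.cov_smul, C.der_mul, C.der_two, C.der_g, C.der_η, C.cov_ξ]
  simp only [hb, C.cov_sub_left, map_sub, LinearMap.sub_apply, hs]
  module

end SasakiLikeAlgebra

namespace SasakiLikeAlgebra

variable {A V : Type*} [CommRing A] [AddCommGroup V] [Module A V] (C : SasakiLikeAlgebra A V)

/-- The Ricci operator, determined by `g(QY, Z) = ρ(Y, Z)`. -/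
noncomputable def ricOp : V →ₗ[A] V :=
  (LinearEquiv.ofBijective C.g C.g_bijective).symm ∘ₗ
    LinearMap.mk₂ A C.ric C.ric_add_left C.ric_smul_left C.ric_add_right C.ric_smul_right

lemma g_ricOp (Y Z : V) : C.g (C.ricOp Y) Z = C.ric Y Z := by
  have h := (LinearEquiv.ofBijective C.g C.g_bijective).apply_symm_apply
    (LinearMap.mk₂ A C.ric C.ric_add_left C.ric_smul_left C.ric_add_right C.ric_smul_right Y)
  exact congrArg (fun α : Module.Dual A V ↦ α Z) h

variable [IsAddTorsionFree A] [Module.Free A V] [Module.Finite A V]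

/-! ### The Ricci tensor of a Sasaki-like structure -/

/-- The Ricci tensor is invariant under the flow of `ξ`: the trace of the Lie derivative of the
curvature vanishes. -/
lemma der_ξ_ric (hφ : LinearMap.trace A V C.φ = 0) (Y Z : V) :
    C.der C.ξ (C.ric Y Z) = C.ric (C.lie C.ξ Y) Z + C.ric Y (C.lie C.ξ Z) := by
  have h := C.der_trace (Module.Free.chooseBasis A V) C.ξ (C.curvEndo Y Z)
    (C.curvEndo (C.lie C.ξ Y) Z + C.curvEndo Y (C.lie C.ξ Z) +
      (2 * C.η Y) • (C.g.flip Z ∘ₗ C.φ).smulRight C.ξ -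
      (2 * C.g (C.φ Y) Z) • C.η.smulRight C.ξ -
      (2 * (C.g Y Z - C.η Y * C.η Z)) • C.φ +
      (2 : A) • (C.g.flip Z - C.η Z • C.η).smulRight (C.φ Y)) fun X ↦ by
        simp only [TorsionFreeConnection.curvEndo_apply, C.lie_ξ_curv, LinearMap.add_apply,
          LinearMap.sub_apply, LinearMap.smul_apply, LinearMap.smulRight_apply,
          LinearMap.comp_apply, LinearMap.flip_apply, smul_eq_mul]
        module
  simp only [map_add, map_sub, map_smul, hφ, LinearMap.trace_smulRight, LinearMap.comp_apply,
    LinearMap.flip_apply, C.φ_ξ, LinearMap.sub_apply, LinearMap.smul_apply, C.η_φ, C.η_ξ,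
    map_zero, smul_eq_mul] at h
  rw [TorsionFreeConnection.ric, h, TorsionFreeConnection.ric, TorsionFreeConnection.ric]
  ring

/-- The trace of `curv_φ` over `X`. -/
lemma ric_φ_right (Y Z : V) : C.ric Y (C.φ Z) =
    LinearMap.trace A V (C.φ ∘ₗ C.curvEndo Y Z) + C.g Y Z * LinearMap.trace A V C.φ -
      Module.finrank A V * C.g (C.φ Y) Z + 2 * C.g (C.φ Y) Z -
      2 * C.η Z * C.η Y * LinearMap.trace A V C.φ := by
  have h : C.curvEndo Y (C.φ Z) = C.φ ∘ₗ C.curvEndo Y Z + C.g Y Z • C.φ -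
      (C.g.flip Z).smulRight (C.φ Y) + (C.g.flip Z ∘ₗ C.φ).smulRight Y -
      C.g (C.φ Y) Z • (1 : V →ₗ[A] V) - (2 * C.η Y) • (C.g.flip Z ∘ₗ C.φ).smulRight C.ξ +
      (2 * C.g (C.φ Y) Z) • C.η.smulRight C.ξ - (2 * C.η Z * C.η Y) • C.φ +
      (2 * C.η Z) • C.η.smulRight (C.φ Y) := by
    ext X
    have h := C.curv_φ X Y Z
    simp only [TorsionFreeConnection.curvEndo_apply, LinearMap.add_apply,
      LinearMap.sub_apply, LinearMap.smul_apply, LinearMap.smulRight_apply,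
      LinearMap.comp_apply, LinearMap.flip_apply, Module.End.one_apply]
    linear_combination (norm := module) h
  rw [TorsionFreeConnection.ric, h]
  simp only [map_add, map_sub, map_smul, LinearMap.trace_smulRight, LinearMap.comp_apply,
    LinearMap.flip_apply, C.φ_ξ, C.η_φ, C.η_ξ, LinearMap.trace_one,
    map_zero, smul_eq_mul]
  ring

/-- The Ricci tensor is symmetric with respect to `φ`, that is, `Q` commutes with `φ`. -/
lemma ric_φ (Y Z : V) : C.ric (C.φ Y) Z = C.ric Y (C.φ Z) := by
  have h : LinearMap.trace A V (C.φ ∘ₗ C.curvEndo Y Z) =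
      LinearMap.trace A V (C.φ ∘ₗ C.curvEndo Z Y) := by
    rw [LinearMap.trace_comp_comm' (C.curvEndo Z Y) C.φ]
    refine C.trace_eq_of_adjoint fun X W ↦ ?_
    simp only [TorsionFreeConnection.curvEndo_apply, LinearMap.comp_apply]
    rw [C.g_φ_left, C.g_curv_pair, C.curv_swap, map_neg, LinearMap.neg_apply, C.g_curv_skew,
      neg_neg]
  rw [C.ric_symm, C.ric_φ_right, C.ric_φ_right, h, C.g_symm Z Y, C.g_φ_left Z, C.g_symm Z]
  ring

/-- `Qξ = (dim M - 1)ξ`, in terms of the Ricci tensor. -/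
lemma ric_ξ (Z : V) : C.ric C.ξ Z = (Module.finrank A V - 1) * C.η Z := by
  have h : C.curvEndo C.ξ Z = C.η Z • (1 : V →ₗ[A] V) - (C.g.flip Z).smulRight C.ξ := by
    ext X
    simp [C.curv_ξ_mid]
  rw [TorsionFreeConnection.ric, h]
  simp only [map_sub, map_smul, LinearMap.trace_smulRight, LinearMap.trace_one, smul_eq_mul,
    LinearMap.flip_apply, C.g_symm C.ξ, C.g_ξ]
  ring

/-- `(∇_X Q)ξ = QφX - 2nφX`, where `2n + 1` is the dimension: `Qξ = 2nξ` and `∇_X ξ = -φX`. -/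
theorem cov_ricOp_ξ (X : V) :
    C.cov X (C.ricOp C.ξ) - C.ricOp (C.cov X C.ξ) =
      C.ricOp (C.φ X) - (Module.finrank A V - 1 : ℤ) • C.φ X := by
  have hQ : C.ricOp C.ξ = (Module.finrank A V - 1 : ℤ) • C.ξ :=
    C.eq_of_g_eq fun Z ↦ by simp [C.g_ricOp, C.ric_ξ, C.g_symm C.ξ, C.g_ξ]
  have hz (k : ℤ) : C.cov X (k • C.ξ) = k • C.cov X C.ξ :=
    map_zsmul (AddMonoidHom.mk' (C.cov X) (C.cov_add X)) k C.ξ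
  rw [hQ, hz, C.cov_ξ, map_neg]
  module

/-- `(∇_ξ Q)Y = 2QφY`: the Ricci tensor is invariant under `ξ`, and `L_ξ Y = ∇_ξ Y + φY`. -/
theorem cov_ξ_ricOp (hφ : LinearMap.trace A V C.φ = 0) (Y : V) :
    C.cov C.ξ (C.ricOp Y) - C.ricOp (C.cov C.ξ Y) = (2 : A) • C.ricOp (C.φ Y) := by
  refine C.eq_of_g_eq fun Z ↦ ?_
  have h₁ := C.der_ξ_ric hφ Y Z
  have h₂ := C.der_g C.ξ (C.ricOp Y) Z
  rw [C.g_ricOp, C.g_ricOp] at h₂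
  rw [C.lie_ξ, C.lie_ξ, C.ric_add_left, C.ric_add_right, ← C.ric_φ] at h₁
  simp only [map_sub, map_smul, LinearMap.sub_apply, LinearMap.smul_apply, smul_eq_mul, C.g_ricOp]
  linear_combination h₁ - h₂

end SasakiLikeAlgebra

/-! ### Smooth functions and vector fields on an open set -/

open Classical in
/-- The extension by zero of a section over `W`. Connections and derivatives act on sections over
all of `M`; at points of the open set `W` the values outside `W` are immaterial. -/
noncomputable def extendZero {M : Type*} {F : M → Type*} [∀ q, Zero (F q)] {W : Set M}
    (X : ∀ q : W, F q) (q : M) : F q :=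
  if h : q ∈ W then X ⟨q, h⟩ else 0

section extendZero

variable {M : Type*} {F : M → Type*} {W : Set M}

lemma extendZero_of_mem [∀ q, Zero (F q)] (X : ∀ q : W, F q) {q : M} (hq : q ∈ W) :
    extendZero X q = X ⟨q, hq⟩ := dif_pos hq

@[simp]
lemma extendZero_coe [∀ q, Zero (F q)] (X : ∀ q : W, F q) (q : W) :
    extendZero X q = X q := dif_pos q.2

lemma extendZero_of_notMem [∀ q, Zero (F q)] (X : ∀ q : W, F q) {q : M} (hq : q ∉ W) :
    extendZero X q = 0 := dif_neg hq

lemma extendZero_add [∀ q, AddZeroClass (F q)] (X Y : ∀ q : W, F q) :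
    extendZero (X + Y) = extendZero X + extendZero Y := by
  ext q
  by_cases hq : q ∈ W <;> simp [extendZero, hq]

lemma extendZero_sub [∀ q, SubNegZeroMonoid (F q)] (X Y : ∀ q : W, F q) :
    extendZero (X - Y) = extendZero X - extendZero Y := by
  ext q
  by_cases hq : q ∈ W <;> simp [extendZero, hq]

lemma extendZero_smul [∀ q, AddCommMonoid (F q)] [∀ q, Module ℝ (F q)] (f : W → ℝ)
    (X : ∀ q : W, F q) :
    extendZero (f • X) = extendZero (F := fun _ ↦ ℝ) f • extendZero X := by
  ext q
  by_cases hq : q ∈ W <;> simp [extendZero, hq]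

lemma extendZero_mul (f h : W → ℝ) :
    extendZero (F := fun _ : M ↦ ℝ) (f * h) =
      extendZero (F := fun _ ↦ ℝ) f * extendZero (F := fun _ ↦ ℝ) h :=
  extendZero_smul (F := fun _ ↦ ℝ) f h

end extendZero

section LocalFields

variable {E : Type*} [NormedAddCommGroup E] [NormedSpace ℝ E]
  {H : Type*} [TopologicalSpace H] {I : ModelWithCorners ℝ E H}
  {M : Type*} [TopologicalSpace M] [ChartedSpace H M]

variable (I) in
/-- The algebra of smooth functions on `W`, as a subalgebra of all functions. -/
noncomputable def smoothFunctions (W : Set M) : Subalgebra ℝ (W → ℝ) where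
  carrier := {f | ContMDiffOn I 𝓘(ℝ) ∞ (extendZero (F := fun _ ↦ ℝ) f) W}
  add_mem' hf hh := by
    rw [Set.mem_ofPred_eq, extendZero_add]; exact hf.add hh
  mul_mem' hf hh := by
    rw [Set.mem_ofPred_eq, extendZero_mul]; exact hf.mul hh
  algebraMap_mem' r := (contMDiffOn_const (c := r)).congr fun q hq ↦ extendZero_of_mem _ hq

variable (I) in
/-- The ring of smooth functions on `W`. -/
def SmoothFun (W : Set M) : Type _ := smoothFunctions I W

namespace SmoothFun

variable {W : Set M}

noncomputable instance : CommRing (SmoothFun I W) :=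
  inferInstanceAs (CommRing (smoothFunctions I W))

/-- A smooth function on `W` as a function on `M`, zero outside `W`. -/
noncomputable def toFun (f : SmoothFun I W) : M → ℝ := extendZero (F := fun _ ↦ ℝ) f.1

lemma ext_toFun {f h : SmoothFun I W} (H : ∀ q ∈ W, f.toFun q = h.toFun q) : f = h :=
  Subtype.ext (funext fun q ↦ by simpa [toFun] using H q q.2)

lemma contMDiffOn_toFun (f : SmoothFun I W) : ContMDiffOn I 𝓘(ℝ) ∞ f.toFun W := f.2

lemma mdiffAt_toFun (hW : IsOpen W) (f : SmoothFun I W) {q : M} (hq : q ∈ W) :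
    MDiffAt f.toFun q :=
  (f.contMDiffOn_toFun.contMDiffAt (hW.mem_nhds hq)).mdifferentiableAt (by simp)

lemma toFun_add (f h : SmoothFun I W) : (f + h).toFun = f.toFun + h.toFun :=
  extendZero_add (F := fun _ ↦ ℝ) f.1 h.1

lemma toFun_mul (f h : SmoothFun I W) : (f * h).toFun = f.toFun * h.toFun :=
  extendZero_mul f.1 h.1

/-- Evaluation at a point of `W`. -/
noncomputable def eval (q : W) : SmoothFun I W →+* ℝ :=
  (Pi.evalRingHom (fun _ : W ↦ ℝ) q).comp (smoothFunctions I W).val.toRingHom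

lemma toFun_of_mem (f : SmoothFun I W) {q : M} (hq : q ∈ W) : f.toFun q = eval ⟨q, hq⟩ f :=
  extendZero_of_mem _ hq

lemma toFun_eq_zero (f : SmoothFun I W) {q : M} (hq : q ∉ W) : f.toFun q = 0 :=
  extendZero_of_notMem _ hq

/-- The restriction to `W` of a function that is smooth on `W`. -/
noncomputable def restrict (W : Set M) (f : M → ℝ) (hf : ContMDiffOn I 𝓘(ℝ) ∞ f W) :
    SmoothFun I W :=
  (⟨fun q ↦ f q, hf.congr fun _ hq ↦ extendZero_of_mem _ hq⟩ : smoothFunctions I W)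

lemma toFun_restrict {f : M → ℝ} (hf : ContMDiffOn I 𝓘(ℝ) ∞ f W) {q : M} (hq : q ∈ W) :
    (restrict W f hf).toFun q = f q := extendZero_of_mem _ hq

/-- A smooth function without zeros is invertible. -/
lemma isUnit_of_ne_zero {f : SmoothFun I W} (hf : ∀ q : W, eval q f ≠ 0) : IsUnit f := by
  have h : ContMDiffOn I 𝓘(ℝ) ∞ (fun q ↦ (f.toFun q)⁻¹) W :=
    f.contMDiffOn_toFun.inv₀ fun q hq ↦ by rw [toFun_of_mem _ hq]; exact hf _
  refine IsUnit.of_mul_eq_one (restrict W _ h) (ext_toFun fun q hq ↦ ?_)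
  rw [toFun_mul, Pi.mul_apply, toFun_restrict _ hq, toFun_of_mem 1 hq, map_one]
  exact mul_inv_cancel₀ (by rw [toFun_of_mem _ hq]; exact hf _)

instance : IsAddTorsionFree (SmoothFun I W) where
  nsmul_right_injective k hk f h hfh := ext_toFun fun q hq ↦ by
    have := congrArg (eval ⟨q, hq⟩) hfh
    rw [toFun_of_mem _ hq, toFun_of_mem _ hq]
    simpa [hk] using this

end SmoothFun

variable [IsManifold I ∞ M]

variable (I) in
/-- The module of smooth vector fields on `W`, as a submodule of all vector fields. -/
noncomputable def smoothFields (W : Set M) :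
    Submodule (smoothFunctions I W) (∀ q : W, TangentSpace I (q : M)) where
  carrier := {X | CMDiff[W] ∞ (T% (extendZero (F := TangentSpace I) X))}
  add_mem' hX hY := by
    rw [Set.mem_ofPred_eq, extendZero_add]; exact hX.add_section hY
  zero_mem' := by
    have h : extendZero (F := TangentSpace I) (0 : ∀ q : W, TangentSpace I (q : M)) = 0 := by
      ext q
      simp [extendZero]
    rw [Set.mem_ofPred_eq, h]
    exact (contMDiff_zeroSection ℝ (fun q : M ↦ TangentSpace I q)).contMDiffOn
  smul_mem' f X hX := by
    have h : extendZero (F := TangentSpace I) (f • X) = _ := extendZero_smul f.1 X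
    rw [Set.mem_ofPred_eq, h]
    exact f.2.smul_section hX

variable (I) in
/-- The module of smooth vector fields on `W`. -/
def SmoothField (W : Set M) : Type _ := smoothFields I W

namespace SmoothField

variable {W : Set M}

noncomputable instance : AddCommGroup (SmoothField I W) :=
  inferInstanceAs (AddCommGroup (smoothFields I W))

noncomputable instance : Module (SmoothFun I W) (SmoothField I W) :=
  inferInstanceAs (Module (smoothFunctions I W) (smoothFields I W))

/-- A smooth vector field on `W` as a vector field on `M`, zero outside `W`. -/
noncomputable def toField (X : SmoothField I W) : ∀ q : M, TangentSpace I q := extendZero X.1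

lemma ext_toField {X Y : SmoothField I W} (h : ∀ q ∈ W, X.toField q = Y.toField q) : X = Y :=
  Subtype.ext (funext fun q ↦ by simpa [toField] using h q q.2)

lemma contMDiffOn_toField (X : SmoothField I W) : CMDiff[W] ∞ (T% X.toField) := X.2

lemma contMDiffAt_toField (hW : IsOpen W) (X : SmoothField I W) {q : M} (hq : q ∈ W) :
    CMDiffAt ∞ (T% X.toField) q := X.contMDiffOn_toField.contMDiffAt (hW.mem_nhds hq)

lemma mdiffAt_toField (hW : IsOpen W) (X : SmoothField I W) {q : M} (hq : q ∈ W) :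
    MDiffAt (T% X.toField) q := (X.contMDiffAt_toField hW hq).mdifferentiableAt (by simp)

lemma toField_eq_zero (X : SmoothField I W) {q : M} (hq : q ∉ W) : X.toField q = 0 :=
  extendZero_of_notMem _ hq

lemma toField_add (X Y : SmoothField I W) : (X + Y).toField = X.toField + Y.toField :=
  extendZero_add X.1 Y.1

lemma toField_sub (X Y : SmoothField I W) : (X - Y).toField = X.toField - Y.toField :=
  extendZero_sub X.1 Y.1

lemma toField_smul (f : SmoothFun I W) (X : SmoothField I W) :
    (f • X).toField = f.toFun • X.toField := extendZero_smul f.1 X.1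

/-- Evaluation at a point, as an additive map. -/
noncomputable def evalHom (q : M) : SmoothField I W →+ TangentSpace I q :=
  AddMonoidHom.mk' (fun X ↦ X.toField q) fun X Y ↦ congrFun (toField_add X Y) q

/-- The restriction to `W` of a vector field that is smooth on `W`. -/
noncomputable def restrict (W : Set M) (X : ∀ q : M, TangentSpace I q) (hX : CMDiff[W] ∞ (T% X)) :
    SmoothField I W :=
  (⟨fun q ↦ X q, hX.congr fun q hq ↦ by rw [extendZero_of_mem _ hq]⟩ : smoothFields I W)

lemma toField_restrict {X : ∀ q : M, TangentSpace I q} (hX : CMDiff[W] ∞ (T% X)) {q : M}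
    (hq : q ∈ W) : (restrict W X hX).toField q = X q := extendZero_of_mem _ hq

/-! ### The tensor fields acting on smooth vector fields -/

/-- The action on smooth vector fields of a smooth field of endomorphisms. -/
noncomputable def applyEndo (φ : ∀ q : M, TangentSpace I q →L[ℝ] TangentSpace I q)
    (hφ : ContMDiff I (I.prod 𝓘(ℝ, E →L[ℝ] E)) ∞ (fun p ↦ TotalSpace.mk' (E →L[ℝ] E)
      (E := fun p : M ↦ TangentSpace I p →L[ℝ] TangentSpace I p) p (φ p))) :
    SmoothField I W →ₗ[SmoothFun I W] SmoothField I W where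
  toFun X := restrict W (fun q ↦ φ q (X.toField q))
    (ContMDiffOn.clm_bundle_apply hφ.contMDiffOn X.contMDiffOn_toField)
  map_add' X Y := ext_toField fun q hq ↦ by
    simp [toField_restrict, hq, toField_add]
  map_smul' f X := ext_toField fun q hq ↦ by
    simp [toField_restrict, hq, toField_smul]

lemma contMDiffOn_applyForm {η : ∀ q : M, TangentSpace I q →L[ℝ] ℝ}
    (hη : ContMDiff I (I.prod 𝓘(ℝ, E →L[ℝ] ℝ)) ∞ (fun p ↦ TotalSpace.mk' (E →L[ℝ] ℝ)
      (E := fun p : M ↦ TangentSpace I p →L[ℝ] ℝ) p (η p))) (X : SmoothField I W) :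
    ContMDiffOn I 𝓘(ℝ) ∞ (fun q ↦ η q (X.toField q)) W := fun q hq ↦ by
  have h := ContMDiffWithinAt.clm_bundle_apply (F₂ := ℝ) (E₂ := Bundle.Trivial M ℝ)
    (hη.contMDiffOn q hq) (X.contMDiffOn_toField q hq)
  exact (Bundle.contMDiffWithinAt_totalSpace.1 h).2

/-- The action on smooth vector fields of a smooth `1`-form. -/
noncomputable def applyForm (η : ∀ q : M, TangentSpace I q →L[ℝ] ℝ)
    (hη : ContMDiff I (I.prod 𝓘(ℝ, E →L[ℝ] ℝ)) ∞ (fun p ↦ TotalSpace.mk' (E →L[ℝ] ℝ)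
      (E := fun p : M ↦ TangentSpace I p →L[ℝ] ℝ) p (η p))) :
    SmoothField I W →ₗ[SmoothFun I W] SmoothFun I W where
  toFun X := SmoothFun.restrict W (fun q ↦ η q (X.toField q)) (contMDiffOn_applyForm hη X)
  map_add' X Y := SmoothFun.ext_toFun fun q hq ↦ by
    simp [SmoothFun.toFun_restrict, hq, toField_add, SmoothFun.toFun_add]
  map_smul' f X := SmoothFun.ext_toFun fun q hq ↦ by
    simp [SmoothFun.toFun_restrict, hq, toField_smul, SmoothFun.toFun_mul]

end SmoothField

lemma PseudoRiemannianMetric.contMDiffOn_val (g : PseudoRiemannianMetric I M) {W : Set M}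
    (X Y : SmoothField I W) :
    ContMDiffOn I 𝓘(ℝ) ∞ (fun q ↦ g.val q (X.toField q) (Y.toField q)) W := fun q hq ↦ by
  have h := ContMDiffWithinAt.clm_bundle_apply₂ (F₃ := ℝ) (E₃ := Bundle.Trivial M ℝ)
    (g.contMDiff.contMDiffOn q hq) (X.contMDiffOn_toField q hq) (Y.contMDiffOn_toField q hq)
  exact (Bundle.contMDiffWithinAt_totalSpace.1 h).2

/-- The metric as a bilinear form on smooth vector fields. -/
noncomputable def PseudoRiemannianMetric.onFields (g : PseudoRiemannianMetric I M) (W : Set M) :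
    SmoothField I W →ₗ[SmoothFun I W] SmoothField I W →ₗ[SmoothFun I W] SmoothFun I W :=
  LinearMap.mk₂ _ (fun X Y ↦ SmoothFun.restrict W (fun q ↦ g.val q (X.toField q) (Y.toField q))
      (g.contMDiffOn_val X Y))
    (fun X X' Y ↦ SmoothFun.ext_toFun fun q hq ↦ by
      simp [SmoothFun.toFun_restrict, hq, SmoothField.toField_add, SmoothFun.toFun_add])
    (fun f X Y ↦ SmoothFun.ext_toFun fun q hq ↦ by
      simp [SmoothFun.toFun_restrict, hq, SmoothField.toField_smul, SmoothFun.toFun_mul])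
    (fun X Y Y' ↦ SmoothFun.ext_toFun fun q hq ↦ by
      simp [SmoothFun.toFun_restrict, hq, SmoothField.toField_add, SmoothFun.toFun_add])
    (fun f X Y ↦ SmoothFun.ext_toFun fun q hq ↦ by
      simp [SmoothFun.toFun_restrict, hq, SmoothField.toField_smul, SmoothFun.toFun_mul])

lemma PseudoRiemannianMetric.toFun_onFields {W : Set M} (g : PseudoRiemannianMetric I M)
    (X Y : SmoothField I W) :
    (g.onFields W X Y).toFun = fun q ↦ g.val q (X.toField q) (Y.toField q) := by
  ext q
  by_cases hq : q ∈ W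
  · exact SmoothFun.toFun_restrict _ hq
  · simp [SmoothFun.toFun_eq_zero _ hq, X.toField_eq_zero hq]

namespace SmoothField

variable {W : Set M}

lemma toFun_applyForm {η : ∀ q : M, TangentSpace I q →L[ℝ] ℝ}
    (hη : ContMDiff I (I.prod 𝓘(ℝ, E →L[ℝ] ℝ)) ∞ (fun p ↦ TotalSpace.mk' (E →L[ℝ] ℝ)
      (E := fun p : M ↦ TangentSpace I p →L[ℝ] ℝ) p (η p))) (X : SmoothField I W) :
    (applyForm η hη X).toFun = fun q ↦ η q (X.toField q) := by
  ext q
  by_cases hq : q ∈ W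
  · exact SmoothFun.toFun_restrict _ hq
  · simp [SmoothFun.toFun_eq_zero _ hq, X.toField_eq_zero hq]

lemma toField_applyEndo {φ : ∀ q : M, TangentSpace I q →L[ℝ] TangentSpace I q}
    (hφ : ContMDiff I (I.prod 𝓘(ℝ, E →L[ℝ] E)) ∞ (fun p ↦ TotalSpace.mk' (E →L[ℝ] E)
      (E := fun p : M ↦ TangentSpace I p →L[ℝ] TangentSpace I p) p (φ p)))
    (X : SmoothField I W) : (applyEndo φ hφ X).toField = fun q ↦ φ q (X.toField q) := by
  ext q
  by_cases hq : q ∈ W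
  · exact toField_restrict _ hq
  · simp [toField_eq_zero _ hq]

end SmoothField

/-- The covariant derivative at `q` depends only on the germ of the section at `q`. -/
lemma CovariantDerivative.congr_of_eventuallyEq
    (nabla : CovariantDerivative I E (fun p : M ↦ TangentSpace I p)) {q : M}
    {Y Y' : ∀ r : M, TangentSpace I r} (hY : MDiffAt (T% Y) q) (h : ∀ᶠ r in 𝓝 q, Y' r = Y r) :
    nabla Y' q = nabla Y q := by
  have hY' : MDiffAt (T% Y') q :=
    hY.congr_of_eventuallyEq (h.mono fun r hr ↦ by simp [hr])
  exact nabla.isCovariantDerivativeOnUniv.congr_of_eventuallyEq hY' hY Filter.univ_mem h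

open SmoothField in
lemma CovariantDerivative.nabla_smul {W : Set M}
    (nabla : CovariantDerivative I E (fun p : M ↦ TangentSpace I p)) (hW : IsOpen W)
    (X : SmoothField I W) (f : SmoothFun I W) (Y : SmoothField I W) {q : M} (hq : q ∈ W) :
    nabla (f • Y).toField q (X.toField q) =
      f.toFun q • nabla Y.toField q (X.toField q) +
        mvfderiv I f.toFun q (X.toField q) • Y.toField q := by
  rw [toField_smul, nabla.isCovariantDerivativeOnUniv.leibniz (Y.mdiffAt_toField hW hq)
    (f.mdiffAt_toFun hW hq)]
  simp

namespace AlmostContactBMetric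

open SmoothField

variable {n : ℕ} (S : AlmostContactBMetric I M n)

/-- The restriction of `ξ` to `W`. -/
noncomputable def ξField (W : Set M) : SmoothField I W := restrict W S.ξ S.contMDiff_ξ.contMDiffOn

lemma toField_ξField {W : Set M} {q : M} (hq : q ∈ W) :
    (S.ξField W).toField q = S.ξ q := toField_restrict _ hq

open SmoothFun in
lemma applyForm_ξField {W : Set M} : applyForm S.η S.contMDiff_η (S.ξField W) = 1 :=
  ext_toFun fun q hq ↦ by
    simp [toFun_applyForm, S.toField_ξField hq, S.η_ξ, toFun_of_mem 1 hq]

end AlmostContactBMetric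

end LocalFields

section LocalStructure

variable {E : Type*} [NormedAddCommGroup E] [NormedSpace ℝ E] [FiniteDimensional ℝ E]
  {H : Type*} [TopologicalSpace H] {I : ModelWithCorners ℝ E H}
  {M : Type*} [TopologicalSpace M] [ChartedSpace H M] [IsManifold I ∞ M]
  {g : PseudoRiemannianMetric I M}
  {nabla : CovariantDerivative I E (fun p : M ↦ TangentSpace I p)} {W : Set M}

namespace PseudoRiemannianMetric.IsLeviCivita

open SmoothField

/-! ### The Levi-Civita connection acting on smooth vector fields -/

lemma contMDiffOn_nabla (hg : g.IsLeviCivita nabla) (hW : IsOpen W) (X Y : SmoothField I W) :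
    CMDiff[W] ∞ (T% (fun q ↦ nabla Y.toField q (X.toField q))) :=
  ContMDiffOn.clm_bundle_apply ((hg.smooth W hW).contMDiff Y.contMDiffOn_toField)
    X.contMDiffOn_toField

/-- The covariant derivative `∇_X Y` of smooth vector fields on `W`. -/
noncomputable def cov (hg : g.IsLeviCivita nabla) (hW : IsOpen W) (X Y : SmoothField I W) :
    SmoothField I W :=
  restrict W (fun q ↦ nabla Y.toField q (X.toField q)) (hg.contMDiffOn_nabla hW X Y)

lemma toField_cov (hg : g.IsLeviCivita nabla) (hW : IsOpen W) (X Y : SmoothField I W) :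
    (hg.cov hW X Y).toField = fun q ↦ nabla Y.toField q (X.toField q) := by
  ext q
  by_cases hq : q ∈ W
  · exact toField_restrict _ hq
  · simp [toField_eq_zero _ hq]

lemma toField_cov_apply (hg : g.IsLeviCivita nabla) (hW : IsOpen W) (X Y : SmoothField I W)
    (q : M) : (hg.cov hW X Y).toField q = nabla Y.toField q (X.toField q) := by
  rw [toField_cov]

variable (hg : g.IsLeviCivita nabla) (hW : IsOpen W)

lemma cov_add_left (X X' Y : SmoothField I W) :
    hg.cov hW (X + X') Y = hg.cov hW X Y + hg.cov hW X' Y :=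
  ext_toField fun q _ ↦ by simp [toField_cov, toField_add]

lemma cov_smul_left (f : SmoothFun I W) (X Y : SmoothField I W) :
    hg.cov hW (f • X) Y = f • hg.cov hW X Y :=
  ext_toField fun q _ ↦ by simp [toField_cov, toField_smul]

lemma cov_add (X Y Y' : SmoothField I W) :
    hg.cov hW X (Y + Y') = hg.cov hW X Y + hg.cov hW X Y' :=
  ext_toField fun q hq ↦ by
    simp [toField_cov, toField_add, nabla.isCovariantDerivativeOnUniv.add
      (Y.mdiffAt_toField hW hq) (Y'.mdiffAt_toField hW hq)]

lemma toField_bracket {X Y : SmoothField I W} {q : M} (hq : q ∈ W) :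
    (hg.cov hW X Y - hg.cov hW Y X).toField q =
      VectorField.mlieBracket I X.toField Y.toField q := by
  simpa [toField_sub, toField_cov] using nabla.torsion_eq_zero_iff.1 hg.torsion_free
    (X.mdiffAt_toField hW hq) (Y.mdiffAt_toField hW hq)

lemma toField_bracket_bracket {X Y Z : SmoothField I W} {q : M} (hq : q ∈ W) :
    (hg.cov hW X (hg.cov hW Y Z - hg.cov hW Z Y) -
      hg.cov hW (hg.cov hW Y Z - hg.cov hW Z Y) X).toField q =
      VectorField.mlieBracket I X.toField (VectorField.mlieBracket I Y.toField Z.toField) q := by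
  rw [toField_bracket hg hW hq]
  refine Filter.EventuallyEq.mlieBracket_vectorField_eq Filter.EventuallyEq.rfl ?_
  filter_upwards [hW.mem_nhds hq] with r hr using toField_bracket hg hW hr

lemma toField_bracket_bracket' {X Y Z : SmoothField I W} {q : M} (hq : q ∈ W) :
    (hg.cov hW (hg.cov hW X Y - hg.cov hW Y X) Z -
      hg.cov hW Z (hg.cov hW X Y - hg.cov hW Y X)).toField q =
      VectorField.mlieBracket I (VectorField.mlieBracket I X.toField Y.toField) Z.toField q := by
  rw [toField_bracket hg hW hq]
  refine Filter.EventuallyEq.mlieBracket_vectorField_eq ?_ Filter.EventuallyEq.rfl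
  filter_upwards [hW.mem_nhds hq] with r hr using toField_bracket hg hW hr

lemma jacobi (X Y Z : SmoothField I W) :
    hg.cov hW X (hg.cov hW Y Z - hg.cov hW Z Y) - hg.cov hW (hg.cov hW Y Z - hg.cov hW Z Y) X =
      (hg.cov hW (hg.cov hW X Y - hg.cov hW Y X) Z -
        hg.cov hW Z (hg.cov hW X Y - hg.cov hW Y X)) +
      (hg.cov hW Y (hg.cov hW X Z - hg.cov hW Z X) -
        hg.cov hW (hg.cov hW X Z - hg.cov hW Z X) Y) :=
  ext_toField fun q hq ↦ by
    have : IsManifold I (minSmoothness ℝ 3) M :=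
      IsManifold.of_le (n := ∞) (by simpa using ENat.LEInfty.out)
    have hs (X : SmoothField I W) : CMDiffAt (minSmoothness ℝ 2) (T% X.toField) q :=
      (X.contMDiffAt_toField hW hq).of_le (by simpa using ENat.LEInfty.out)
    rw [toField_add, Pi.add_apply, toField_bracket_bracket hg hW hq,
      toField_bracket_bracket hg hW hq, toField_bracket_bracket' hg hW hq]
    exact VectorField.leibniz_identity_mlieBracket_apply (hs X) (hs Y) (hs Z)

end PseudoRiemannianMetric.IsLeviCivita

/-! ### Derivatives of smooth functions along vector fields -/

namespace AlmostContactBMetric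

open SmoothField SmoothFun

variable {n : ℕ} (S : AlmostContactBMetric I M n)

variable (hg : S.g.IsLeviCivita nabla) (hW : IsOpen W)

include hg hW in
/-- Smoothness of `X f` follows from that of the connection, since
`X f = η(∇_X (fξ) - f ∇_X ξ)`. -/
lemma contMDiffOn_der (X : SmoothField I W) (f : SmoothFun I W) :
    ContMDiffOn I 𝓘(ℝ) ∞ (fun q ↦ mvfderiv I f.toFun q (X.toField q)) W := by
  refine (applyForm S.η S.contMDiff_η (hg.cov hW X (f • S.ξField W) -
    f • hg.cov hW X (S.ξField W))).contMDiffOn_toFun.congr fun q hq ↦ ?_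
  simp only [toFun_applyForm, toField_sub, hg.toField_cov, toField_smul f (hg.cov _ _ _),
    Pi.sub_apply, Pi.smul_apply']
  rw [nabla.nabla_smul hW X f _ hq, add_sub_cancel_left, map_smul,
    S.toField_ξField hq, S.η_ξ, smul_eq_mul, mul_one]

/-- The derivative `X f` of a smooth function along a smooth vector field. -/
noncomputable def derFun (X : SmoothField I W) (f : SmoothFun I W) : SmoothFun I W :=
  SmoothFun.restrict W (fun q ↦ mvfderiv I f.toFun q (X.toField q)) (S.contMDiffOn_der hg hW X f)

lemma toFun_derFun (X : SmoothField I W) (f : SmoothFun I W) :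
    (S.derFun hg hW X f).toFun = fun q ↦ mvfderiv I f.toFun q (X.toField q) := by
  ext q
  by_cases hq : q ∈ W
  · exact SmoothFun.toFun_restrict _ hq
  · simp [SmoothFun.toFun_eq_zero _ hq, X.toField_eq_zero hq]

lemma cov_smul (X : SmoothField I W) (f : SmoothFun I W) (Y : SmoothField I W) :
    hg.cov hW X (f • Y) = f • hg.cov hW X Y + S.derFun hg hW X f • Y :=
  ext_toField fun q hq ↦ by
    simp only [toField_add, toField_smul f (hg.cov _ _ _), hg.toField_cov, Pi.add_apply,
      Pi.smul_apply', toField_smul (S.derFun _ _ _ _), toFun_derFun]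
    exact nabla.nabla_smul hW X f Y hq

lemma derFun_add (X : SmoothField I W) (f h : SmoothFun I W) :
    S.derFun hg hW X (f + h) = S.derFun hg hW X f + S.derFun hg hW X h :=
  ext_toFun fun q hq ↦ by
    simp [toFun_derFun, toFun_add, mvfderiv_add (f.mdiffAt_toFun hW hq) (h.mdiffAt_toFun hW hq)]

lemma derFun_mul (X : SmoothField I W) (f h : SmoothFun I W) :
    S.derFun hg hW X (f * h) = f * S.derFun hg hW X h + h * S.derFun hg hW X f :=
  ext_toFun fun q hq ↦ by
    simp [toFun_derFun, toFun_add, toFun_mul,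
      mvfderiv_mul (f.mdiffAt_toFun hW hq) (h.mdiffAt_toFun hW hq)]

/-- The bracket acts on functions as the commutator: compare the coefficients of `ξ` in the Jacobi
identity for `X`, `Y` and `fξ`. -/
lemma derFun_bracket (X Y : SmoothField I W) (f : SmoothFun I W) :
    S.derFun hg hW (hg.cov hW X Y - hg.cov hW Y X) f =
      S.derFun hg hW X (S.derFun hg hW Y f) - S.derFun hg hW Y (S.derFun hg hW X f) := by
  have hsub (X Y Z : SmoothField I W) : hg.cov hW X (Y - Z) = hg.cov hW X Y - hg.cov hW X Z :=
    (AddMonoidHom.mk' _ (hg.cov_add hW X)).map_sub Y Z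
  have hsub' (X Y Z : SmoothField I W) : hg.cov hW (X - Y) Z = hg.cov hW X Z - hg.cov hW Y Z :=
    (AddMonoidHom.mk' (fun X ↦ hg.cov hW X Z) fun X Y ↦ hg.cov_add_left hW X Y Z).map_sub X Y
  have h := hg.jacobi hW X Y (f • S.ξField W)
  have h₀ := hg.jacobi hW X Y (S.ξField W)
  simp only [S.cov_smul hg hW, hg.cov_smul_left hW, hg.cov_add hW, hg.cov_add_left hW, hsub,
    hsub'] at h h₀
  have hb : (S.derFun hg hW (hg.cov hW X Y - hg.cov hW Y X) f) • S.ξField W =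
      (S.derFun hg hW X (S.derFun hg hW Y f) - S.derFun hg hW Y (S.derFun hg hW X f)) •
        S.ξField W := by
    linear_combination (norm := module) f • h₀ - h
  simpa [S.applyForm_ξField] using congrArg (applyForm S.η S.contMDiff_η) hb

end AlmostContactBMetric

end LocalStructure

section Frame

variable {E : Type*} [NormedAddCommGroup E] [NormedSpace ℝ E] [FiniteDimensional ℝ E]
  {H : Type*} [TopologicalSpace H] {I : ModelWithCorners ℝ E H}
  {M : Type*} [TopologicalSpace M] [ChartedSpace H M] [IsManifold I ∞ M] {W : Set M}

namespace SmoothField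

open SmoothFun

/-! ### Local frames, and the metric as an isomorphism -/

variable {ι : Type*} [Fintype ι] (b : Module.Basis ι ℝ E) {p : M}
  (hW : IsOpen W) (hWp : W ⊆ (trivializationAt E (TangentSpace I : M → Type _) p).baseSet)

/-- Over an open set on which the tangent bundle is trivialized, the smooth vector fields have a
basis: the frame induced by the trivialization and a basis of the model space. -/
noncomputable def frame : Module.Basis ι (SmoothFun I W) (SmoothField I W) :=
  letI e := trivializationAt E (TangentSpace I : M → Type _) p
  have h₁ (i : ι) : CMDiff[W] ∞ (T% (e.localFrame b i)) :=
    (e.contMDiffOn_localFrame_baseSet ∞ b i).mono hWp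
  have h₂ (i : ι) (X : SmoothField I W) :
      ContMDiffOn I 𝓘(ℝ) ∞ (fun q ↦ e.localFrameCoeff I b i q (X.toField q)) W :=
    contMDiffOn_localFrameCoeff b hW hWp X.contMDiffOn_toField i
  have toField_sum (s : Finset ι) (X : ι → SmoothField I W) (q : M) :
      (∑ i ∈ s, X i).toField q = ∑ i ∈ s, (X i).toField q := map_sum (evalHom q) X s
  Module.Basis.ofEquivFun
    { toFun := fun X i ↦ SmoothFun.restrict W _ (h₂ i X)
      invFun := fun c ↦ ∑ i, c i • restrict W _ (h₁ i)
      map_add' := fun X Y ↦ funext fun i ↦ ext_toFun fun q hq ↦ by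
        rw [Pi.add_apply, toFun_add, Pi.add_apply]
        simp only [SmoothFun.toFun_restrict _ hq]
        simp [toField_add]
      map_smul' := fun f X ↦ funext fun i ↦ ext_toFun fun q hq ↦ by
        rw [Pi.smul_apply, smul_eq_mul, toFun_mul, Pi.mul_apply]
        simp only [SmoothFun.toFun_restrict _ hq]
        simp [toField_smul]
      left_inv := fun X ↦ ext_toField fun q hq ↦ by
        rw [toField_sum]
        simp only [toField_smul, Pi.smul_apply', toField_restrict _ hq,
          SmoothFun.toFun_restrict _ hq]
        exact (e.eq_sum_localFrameCoeff_smul (hWp hq)).symm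
      right_inv := fun c ↦ funext fun i ↦ ext_toFun fun q hq ↦ by
        classical
        have hc (j : ι) : e.localFrameCoeff I b i q (e.localFrame b j q) =
            if j = i then 1 else 0 := by
          rw [e.localFrameCoeff_apply_of_mem_baseSet b (hWp hq) (e.localFrame b j) i,
            e.localFrame_apply_of_mem_baseSet b (hWp hq), Module.Basis.repr_self,
            Finsupp.single_apply]
        rw [SmoothFun.toFun_restrict _ hq, toField_sum]
        simp only [toField_smul, Pi.smul_apply', toField_restrict _ hq, map_sum, map_smul, hc]
        simp }

/-- The values of the frame at a point of `W` form a basis of the tangent space. -/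
noncomputable def frameAt (q : W) : Module.Basis ι ℝ (TangentSpace I (q : M)) :=
  (trivializationAt E (TangentSpace I : M → Type _) p).basisAt b (hWp q.2)

lemma frameAt_repr (X : SmoothField I W) (i : ι) {q : M} (hq : q ∈ W) :
    (frameAt b hWp ⟨q, hq⟩).repr (X.toField q) i = ((frame b hW hWp).repr X i).toFun q := by
  rw [frame, Module.Basis.ofEquivFun_repr_apply]
  refine Eq.trans ?_ (SmoothFun.toFun_restrict _ hq).symm
  exact (Bundle.Trivialization.localFrameCoeff_apply_of_mem_baseSet _ b (hWp hq) X.toField i).symm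

lemma toField_frame (i : ι) {q : M} (hq : q ∈ W) :
    (frame b hW hWp i).toField q = frameAt b hWp ⟨q, hq⟩ i := by
  classical
  refine (frameAt b hWp ⟨q, hq⟩).ext_elem fun j ↦ ?_
  rw [frameAt_repr b hW hWp _ _ hq, toFun_of_mem _ hq]
  simp only [Module.Basis.repr_self, Finsupp.single_apply]
  split_ifs <;> simp

/-- Every tangent vector at a point of `W` is the value of a smooth vector field on `W`. -/
lemma exists_toField_eq (hW : IsOpen W)
    (hWp : W ⊆ (trivializationAt E (TangentSpace I : M → Type _) p).baseSet)
    {q : M} (hq : q ∈ W) (v : TangentSpace I q) :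
    ∃ X : SmoothField I W, X.toField q = v := by
  let b := Module.finBasis ℝ E
  refine ⟨∑ i, SmoothFun.restrict W (fun _ ↦ (frameAt b hWp ⟨q, hq⟩).repr v i)
    (contMDiffOn_const (I := I)) • frame b hW hWp i, (frameAt b hWp ⟨q, hq⟩).ext_elem fun i ↦ ?_⟩
  rw [frameAt_repr b hW hWp _ _ hq, Module.Basis.repr_sum_self, SmoothFun.toFun_restrict _ hq]

/-- The trace of an endomorphism of the module of smooth vector fields is computed pointwise. -/
lemma toFun_trace (hW : IsOpen W)
    (hWp : W ⊆ (trivializationAt E (TangentSpace I : M → Type _) p).baseSet)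
    {q : M} (hq : q ∈ W) (T : SmoothField I W →ₗ[SmoothFun I W] SmoothField I W)
    (T₀ : TangentSpace I q →ₗ[ℝ] TangentSpace I q)
    (h : ∀ X : SmoothField I W, (T X).toField q = T₀ (X.toField q)) :
    (LinearMap.trace _ _ T).toFun q = LinearMap.trace ℝ _ T₀ := by
  let b := Module.finBasis ℝ E
  rw [LinearMap.trace_eq_matrix_trace _ (frame b hW hWp),
    LinearMap.trace_eq_matrix_trace _ (frameAt b hWp ⟨q, hq⟩), toFun_of_mem _ hq]
  simp only [Matrix.trace, map_sum, Matrix.diag_apply, LinearMap.toMatrix_apply]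
  refine Finset.sum_congr rfl fun i _ ↦ ?_
  rw [← toFun_of_mem, ← frameAt_repr b hW hWp _ _ hq, h, toField_frame b hW hWp _ hq]

/-- Over a trivializing open set the metric identifies vector fields and `1`-forms, since its Gram
determinant vanishes nowhere. -/
lemma onFields_bijective (hW : IsOpen W)
    (hWp : W ⊆ (trivializationAt E (TangentSpace I : M → Type _) p).baseSet)
    (g : PseudoRiemannianMetric I M) :
    Function.Bijective (g.onFields W) := by
  classical
  let b := Module.finBasis ℝ E
  let B := frame b hW hWp
  have hdet : IsUnit (LinearMap.toMatrix B B.dualBasis (g.onFields W)).det := by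
    refine isUnit_of_ne_zero fun q ↦ ?_
    let c := frameAt b hWp q
    have hc : (eval q).mapMatrix (LinearMap.toMatrix B B.dualBasis (g.onFields W)) =
        (LinearMap.BilinForm.toMatrix c (g.bilin q)).transpose := by
      ext i j
      simp only [RingHom.mapMatrix_apply, Matrix.map_apply, LinearMap.toMatrix_apply,
        Matrix.transpose_apply, LinearMap.BilinForm.toMatrix_apply, Module.Basis.dualBasis_repr]
      have h := toFun_of_mem (g.onFields W (B j) (B i)) q.2
      have hB (i) : (B i).toField q = c i := toField_frame b hW hWp i q.2
      simp only [g.toFun_onFields, hB] at h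
      exact h.symm
    rw [RingHom.map_det, hc, Matrix.det_transpose]
    exact (LinearMap.BilinForm.nondegenerate_iff_det_ne_zero c).1 (g.bilin_nondegenerate q)
  exact (LinearEquiv.ofIsUnitDet hdet).bijective

end SmoothField

end Frame

/-! ### The trace of `φ` -/

/-- A real endomorphism with `T³ = -T` has trace zero: over `ℂ`, `-(T² + iT)/2` is idempotent, so
its trace is a natural number, whose imaginary part is `-(tr T)/2`. -/
lemma LinearMap.trace_eq_zero_of_cube_eq_neg {V : Type*} [AddCommGroup V] [Module ℝ V]
    [FiniteDimensional ℝ V] (T : V →ₗ[ℝ] V) (hT : ∀ v, T (T (T v)) = -T v) :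
    LinearMap.trace ℝ V T = 0 := by
  classical
  let b := Module.finBasis ℝ V
  let A := LinearMap.toMatrix b b T
  have hA : A * A * A = -A := by
    have h : T * T * T = -T := LinearMap.ext hT
    simpa [A, LinearMap.toMatrix_mul, Module.End.mul_eq_comp, LinearMap.toMatrix_comp b b b] using
      congrArg (LinearMap.toMatrix b b) h
  let B : Matrix _ _ ℂ := A.map Complex.ofRealHom
  have hB : B * B * B = -B := by
    have := congrArg (Complex.ofRealHom.mapMatrix) hA
    rw [map_mul, map_mul, map_neg] at this
    exact this
  let P : Matrix _ _ ℂ := (-(1 / 2) : ℂ) • (B * B + Complex.I • B)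
  have hP : P * P = P := by
    have hB' : B * (B * B) = -B := by rw [← mul_assoc, hB]
    have h : P * P = (1 / 4 : ℂ) • (B * B * B * B + (2 * Complex.I) • (B * B * B) +
        (Complex.I * Complex.I) • (B * B)) := by
      simp only [P, mul_add, add_mul, smul_mul_assoc, mul_smul_comm, mul_assoc]
      module
    rw [h, hB, Complex.I_mul_I]
    simp only [P, neg_mul]
    module
  have hidem : IsIdempotentElem (Matrix.toLin' P) := by
    rw [IsIdempotentElem, Module.End.mul_eq_comp, ← Matrix.toLin'_mul, hP]
  have htr := (LinearMap.IsIdempotentElem.isProj_range _ hidem).trace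
  rw [Matrix.trace_toLin'_eq] at htr
  have him := congrArg Complex.im htr
  have hre (C : Matrix (Fin (Module.finrank ℝ V)) (Fin (Module.finrank ℝ V)) ℝ) :
      (C.map Complex.ofRealHom).trace = (C.trace : ℂ) := by
    simp [Matrix.trace]
  have hBB : B * B = (A * A).map Complex.ofRealHom := (Matrix.map_mul).symm
  rw [LinearMap.trace_eq_matrix_trace ℝ b]
  simp only [P, Matrix.trace_smul, Matrix.trace_add, hBB] at him
  rw [hre, hre] at him
  simpa using him

section LocalAlgebra

variable {E : Type*} [NormedAddCommGroup E] [NormedSpace ℝ E] [FiniteDimensional ℝ E]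
  {H : Type*} [TopologicalSpace H] {I : ModelWithCorners ℝ E H}
  {M : Type*} [TopologicalSpace M] [ChartedSpace H M] [IsManifold I ∞ M]
  {nabla : CovariantDerivative I E (fun p : M ↦ TangentSpace I p)} {W : Set M}

/-! ### The Sasaki-like algebra of a trivializing open set -/

namespace AlmostContactBMetric

open SmoothField SmoothFun

variable {n : ℕ} (S : AlmostContactBMetric I M n)

/-- The smooth vector fields on a trivializing open set, with the Levi-Civita connection and the
structure tensors of a Sasaki-like manifold. -/
noncomputable def localAlgebra (hg : S.g.IsLeviCivita nabla) (hS : S.IsSasakiLike nabla)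
    (hW : IsOpen W) {p : M}
    (hWp : W ⊆ (trivializationAt E (TangentSpace I : M → Type _) p).baseSet) :
    SasakiLikeAlgebra (SmoothFun I W) (SmoothField I W) where
  der := S.derFun hg hW
  cov := hg.cov hW
  der_add := S.derFun_add hg hW
  der_mul := S.derFun_mul hg hW
  cov_add_left := hg.cov_add_left hW
  cov_smul_left := hg.cov_smul_left hW
  cov_add := hg.cov_add hW
  cov_smul := S.cov_smul hg hW
  der_bracket := S.derFun_bracket hg hW
  jacobi := hg.jacobi hW
  g := S.g.onFields W
  φ := applyEndo S.φ S.contMDiff_φ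
  ξ := S.ξField W
  η := applyForm S.η S.contMDiff_η
  g_symm X Y := ext_toFun fun q _ ↦ by
    simp only [S.g.toFun_onFields]
    exact S.g.symm q _ _
  g_bijective := onFields_bijective hW hWp S.g
  der_g X Y Z := ext_toFun fun q hq ↦ by
    simp only [toFun_derFun, toFun_add, S.g.toFun_onFields, hg.toField_cov, Pi.add_apply]
    exact hg.metric q _ _ _ (Y.mdiffAt_toField hW hq) (Z.mdiffAt_toField hW hq)
  φ_ξ := ext_toField fun q hq ↦ by
    simp only [toField_applyEndo, S.toField_ξField hq, S.φ_ξ]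
    exact (map_zero (evalHom q)).symm
  φ_φ X := ext_toField fun q hq ↦ by
    have hneg : (-X).toField q = -X.toField q := map_neg (evalHom q) X
    simp only [toField_applyEndo, toField_add, Pi.add_apply, toField_smul, Pi.smul_apply',
      S.toField_ξField hq, toFun_applyForm, S.φ_φ, hneg]
  η_φ X := ext_toFun fun q hq ↦ by
    rw [toFun_applyForm, toField_applyEndo, toFun_of_mem 0 hq, map_zero]
    exact S.η_φ q _
  η_ξ := S.applyForm_ξField
  g_φ_φ X Y := ext_toFun fun q hq ↦ by
    have hneg : (-S.g.onFields W X Y).toFun q = -(S.g.onFields W X Y).toFun q := by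
      simp only [toFun_of_mem _ hq, map_neg]
    simp only [toFun_add, Pi.add_apply, toFun_mul, Pi.mul_apply, hneg, S.g.toFun_onFields,
      toField_applyEndo, toFun_applyForm, S.g_φ_φ]
  cov_φ X Y := ext_toField fun q hq ↦ by
    have h := hS q (X.toField q) Y.toField (Y.contMDiffAt_toField hW hq)
    have hneg : (-S.g.onFields W X Y).toFun q = -(S.g.onFields W X Y).toFun q := by
      simp only [toFun_of_mem _ hq, map_neg]
    have htwo : (2 : SmoothFun I W).toFun q = 2 := by rw [toFun_of_mem _ hq, map_ofNat]
    simp only [toField_sub, toField_add, toField_smul, Pi.sub_apply, Pi.add_apply, Pi.smul_apply',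
      toFun_mul, Pi.mul_apply, hneg, htwo, S.g.toFun_onFields, hg.toField_cov,
      toField_applyEndo, toFun_applyForm, S.toField_ξField hq]
    exact h

lemma trace_φ_localAlgebra (hg : S.g.IsLeviCivita nabla) (hS : S.IsSasakiLike nabla)
    (hW : IsOpen W) {p : M}
    (hWp : W ⊆ (trivializationAt E (TangentSpace I : M → Type _) p).baseSet) :
    LinearMap.trace _ _ (S.localAlgebra hg hS hW hWp).φ = 0 :=
  ext_toFun fun q hq ↦ by
    have h : ∀ X, ((S.localAlgebra hg hS hW hWp).φ X).toField q =
        (S.φ q).toLinearMap (X.toField q) :=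
      fun X ↦ congrFun (toField_applyEndo S.contMDiff_φ X) q
    have : FiniteDimensional ℝ (TangentSpace I q) := inferInstanceAs (FiniteDimensional ℝ E)
    rw [toFun_trace hW hWp hq _ _ h, toFun_of_mem 0 hq, map_zero]
    exact LinearMap.trace_eq_zero_of_cube_eq_neg _ fun v ↦ by
      simp [S.φ_φ, S.φ_ξ]

end AlmostContactBMetric

end LocalAlgebra

section CurvatureAtPoint

variable {E : Type*} [NormedAddCommGroup E] [NormedSpace ℝ E] [FiniteDimensional ℝ E]
  {H : Type*} [TopologicalSpace H] {I : ModelWithCorners ℝ E H}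
  {M : Type*} [TopologicalSpace M] [ChartedSpace H M] [IsManifold I ∞ M]
  {nabla : CovariantDerivative I E (fun p : M ↦ TangentSpace I p)} {W : Set M}

open SmoothField SmoothFun

/-! ### Curvature and Ricci operator at a point -/

/-- A linear endomorphism of the module of smooth vector fields acts pointwise. -/
lemma SmoothField.toField_eq_zero_of_linear {p : M} (hW : IsOpen W)
    (hWp : W ⊆ (trivializationAt E (TangentSpace I : M → Type _) p).baseSet) {q : M} (hq : q ∈ W)
    (T : SmoothField I W →ₗ[SmoothFun I W] SmoothField I W) {X : SmoothField I W}
    (hX : X.toField q = 0) : (T X).toField q = 0 := by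
  let b := Module.finBasis ℝ E
  rw [← (frame b hW hWp).sum_repr X, map_sum]
  refine (map_sum (evalHom q) _ _).trans (Finset.sum_eq_zero fun i _ ↦ ?_)
  rw [map_smul]
  change SmoothField.toField (_ • _) q = 0
  rw [toField_smul, Pi.smul_apply', ← frameAt_repr b hW hWp _ _ hq, hX]
  simp

namespace AlmostContactBMetric

variable {n : ℕ} (S : AlmostContactBMetric I M n)
  (hg : S.g.IsLeviCivita nabla) (hS : S.IsSasakiLike nabla) (hW : IsOpen W) {p : M}
  (hWp : W ⊆ (trivializationAt E (TangentSpace I : M → Type _) p).baseSet)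

/-- The curvature of vector fields is tensorial. -/
lemma toField_curv_congr {q : M} (hq : q ∈ W) {X Y Z X' Y' Z' : SmoothField I W}
    (hX : X.toField q = X'.toField q) (hY : Y.toField q = Y'.toField q)
    (hZ : Z.toField q = Z'.toField q) :
    ((S.localAlgebra hg hS hW hWp).curv X Y Z).toField q =
      ((S.localAlgebra hg hS hW hWp).curv X' Y' Z').toField q := by
  set C := S.localAlgebra hg hS hW hWp
  have key (T : SmoothField I W →ₗ[SmoothFun I W] SmoothField I W) {U U' : SmoothField I W}
      (h : U.toField q = U'.toField q) : (T U).toField q = (T U').toField q := by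
    rw [← sub_eq_zero, ← Pi.sub_apply, ← toField_sub, ← map_sub]
    exact toField_eq_zero_of_linear hW hWp hq T (by rw [toField_sub, Pi.sub_apply, h, sub_self])
  calc (C.curv X Y Z).toField q = (C.curv X' Y Z).toField q := key (C.curvEndo Y Z) hX
    _ = (C.curv X' Y' Z).toField q :=
      key { toFun := fun Y ↦ C.curv X' Y Z
            map_add' := fun Y Y' ↦ C.curv_add_mid X' Y Y' Z
            map_smul' := fun f Y ↦ C.curv_smul_mid f X' Y Z } hY
    _ = (C.curv X' Y' Z').toField q :=
      key { toFun := fun Z ↦ C.curv X' Y' Z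
            map_add' := C.curv_add_right X' Y'
            map_smul' := fun f ↦ C.curv_smul_right f X' Y' } hZ

/-- The curvature of vector fields on `M` that are smooth on `W` is computed on `W`: each covariant
derivative and bracket involves only germs at points of `W`. -/
lemma curvatureField_eq {q : M} (hq : q ∈ W) {X Y Z : ∀ r : M, TangentSpace I r}
    (hX : CMDiff[W] ∞ (T% X)) (hY : CMDiff[W] ∞ (T% Y)) (hZ : CMDiff[W] ∞ (T% Z)) :
    curvatureField nabla X Y Z q = ((S.localAlgebra hg hS hW hWp).curv
      (restrict W X hX) (restrict W Y hY) (restrict W Z hZ)).toField q := by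
  have hnear {U : ∀ r : M, TangentSpace I r} (hU : CMDiff[W] ∞ (T% U)) {r : M} (hr : r ∈ W) :
      ∀ᶠ s in 𝓝 r, U s = (restrict W U hU).toField s := by
    filter_upwards [hW.mem_nhds hr] with s hs using (toField_restrict hU hs).symm
  have hcov {U V : ∀ r : M, TangentSpace I r} (hU : CMDiff[W] ∞ (T% U)) (hV : CMDiff[W] ∞ (T% V))
      {r : M} (hr : r ∈ W) : nabla V r (U r) =
        (hg.cov hW (restrict W U hU) (restrict W V hV)).toField r := by
    rw [hg.toField_cov_apply, nabla.congr_of_eventuallyEq (mdiffAt_toField hW _ hr) (hnear hV hr),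
      toField_restrict hU hr]
  have hcov₂ {U V T : ∀ r : M, TangentSpace I r} (hU : CMDiff[W] ∞ (T% U))
      (hV : CMDiff[W] ∞ (T% V)) (hT : CMDiff[W] ∞ (T% T)) :
      nabla (fun r ↦ nabla T r (V r)) q (U q) = (hg.cov hW (restrict W U hU)
        (hg.cov hW (restrict W V hV) (restrict W T hT))).toField q := by
    rw [nabla.congr_of_eventuallyEq (mdiffAt_toField hW
      (hg.cov hW (restrict W V hV) (restrict W T hT)) hq),
      hg.toField_cov_apply hW (restrict W U hU), toField_restrict hU hq]
    filter_upwards [hW.mem_nhds hq] with r hr using hcov hV hT hr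
  have hbr : VectorField.mlieBracket I X Y q = (hg.cov hW (restrict W X hX) (restrict W Y hY) -
      hg.cov hW (restrict W Y hY) (restrict W X hX)).toField q := by
    rw [hg.toField_bracket hW hq]
    exact Filter.EventuallyEq.mlieBracket_vectorField_eq (hnear hX hq) (hnear hY hq)
  rw [curvatureField, hcov₂ hX hY hZ, hcov₂ hY hX hZ, hbr,
    nabla.congr_of_eventuallyEq (mdiffAt_toField hW _ hq) (hnear hZ hq)]
  change _ = SmoothField.toField (hg.cov hW _ (hg.cov hW _ _) - hg.cov hW _ (hg.cov hW _ _) -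
    hg.cov hW (hg.cov hW _ _ - hg.cov hW _ _) _) q
  simp only [toField_sub, Pi.sub_apply, hg.toField_cov_apply, hg.toField_cov]

/-- The curvature tensor at a point is the value of the curvature of vector fields. -/
lemma curvature_eq {q : M} (hq : q ∈ W) (X Y Z : SmoothField I W) :
    curvature nabla q (X.toField q) (Y.toField q) (Z.toField q) =
      ((S.localAlgebra hg hS hW hWp).curv X Y Z).toField q := by
  -- The extensions defining `curvature` are smooth on the trivializing set at `q`, so the
  -- comparison takes place on its intersection with `W`.
  let e := trivializationAt E (TangentSpace I : M → Type _) q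
  have hW' : IsOpen (W ∩ e.baseSet) := hW.inter e.open_baseSet
  have hWp' := (Set.inter_subset_left (s := W) (t := e.baseSet)).trans hWp
  have hq' : q ∈ W ∩ e.baseSet := ⟨hq, mem_baseSet_trivializationAt' q⟩
  have hext (v : TangentSpace I q) : CMDiff[W ∩ e.baseSet] ∞ (T% (extend E v)) := by
    refine ContMDiffOn.mono ?_ Set.inter_subset_right
    rw [e.contMDiffOn_section_baseSet_iff]
    refine (contMDiffOn_const (c := (e ⟨q, v⟩).2)).congr fun r hr ↦ ?_
    simp [extend, e.apply_mk_symm hr, e]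
  have hres (U : SmoothField I W) : CMDiff[W ∩ e.baseSet] ∞ (T% U.toField) :=
    U.contMDiffOn_toField.mono Set.inter_subset_left
  have hself (U : SmoothField I W) : restrict W U.toField U.contMDiffOn_toField = U :=
    ext_toField fun r hr ↦ toField_restrict _ hr
  have h := S.curvatureField_eq hg hS hW hWp hq X.contMDiffOn_toField Y.contMDiffOn_toField
    Z.contMDiffOn_toField
  rw [hself, hself, hself] at h
  rw [← h, curvature, S.curvatureField_eq hg hS hW' hWp' hq' (hext _) (hext _) (hext _),
    S.curvatureField_eq hg hS hW' hWp' hq' (hres X) (hres Y) (hres Z)]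
  refine S.toField_curv_congr hg hS hW' hWp' hq' ?_ ?_ ?_ <;>
  rw [toField_restrict _ hq', toField_restrict _ hq', extend_apply_self]

/-- The Ricci tensor at a point is the value of the Ricci tensor of vector fields. -/
lemma ricci_eq {q : M} (hq : q ∈ W) (Y Z : SmoothField I W) :
    ricci nabla q (Y.toField q) (Z.toField q) =
      ((S.localAlgebra hg hS hW hWp).ric Y Z).toFun q := by
  set C := S.localAlgebra hg hS hW hWp
  let T₀ : TangentSpace I q →ₗ[ℝ] TangentSpace I q :=
    { toFun := fun x ↦ curvature nabla q x (Y.toField q) (Z.toField q)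
      map_add' := fun x x' ↦ by
        obtain ⟨X, rfl⟩ := exists_toField_eq hW hWp hq x
        obtain ⟨X', rfl⟩ := exists_toField_eq hW hWp hq x'
        rw [← Pi.add_apply, ← toField_add, S.curvature_eq hg hS hW hWp hq,
          S.curvature_eq hg hS hW hWp hq, S.curvature_eq hg hS hW hWp hq, ← Pi.add_apply,
          ← toField_add, C.curv_add_left]
      map_smul' := fun r x ↦ by
        obtain ⟨X, rfl⟩ := exists_toField_eq hW hWp hq x
        let f : SmoothFun I W := SmoothFun.restrict W (fun _ ↦ r) (contMDiffOn_const (I := I))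
        have hf : f.toFun q = r := SmoothFun.toFun_restrict _ hq
        have hsmul (U : SmoothField I W) : r • U.toField q = (f • U).toField q := by
          rw [toField_smul, Pi.smul_apply', hf]
        rw [RingHom.id_apply, S.curvature_eq hg hS hW hWp hq, hsmul, hsmul,
          S.curvature_eq hg hS hW hWp hq, C.curv_smul_left] }
  have h := toFun_trace hW hWp hq (C.curvEndo Y Z) T₀ fun X ↦
    (S.curvature_eq hg hS hW hWp hq X Y Z).symm
  rw [TorsionFreeConnection.ric, h, LinearMap.trace_eq_matrix_trace ℝ (tangentBasis (I := I) q)]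
  simp [Matrix.trace, ricci, LinearMap.toMatrix_apply, T₀]

/-- The Ricci operator at a point is the value of the Ricci operator of vector fields. -/
lemma ricciOperator_eq {q : M} (hq : q ∈ W) (Y : SmoothField I W) :
    ricciOperator S.g nabla q (Y.toField q) =
      ((S.localAlgebra hg hS hW hWp).ricOp Y).toField q := by
  set C := S.localAlgebra hg hS hW hWp
  refine sub_eq_zero.1 (S.g.nondegenerate q _ fun w ↦ ?_)
  have hlin : (S.g.val q (ricciOperator S.g nabla q (Y.toField q) - (C.ricOp Y).toField q) :
      TangentSpace I q →ₗ[ℝ] ℝ) = 0 := by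
    refine (tangentBasis (I := I) q).ext fun k ↦ ?_
    obtain ⟨Z, hZ⟩ := exists_toField_eq hW hWp hq (tangentBasis (I := I) q k)
    have h : C.g (C.ricOp Y) Z = C.ric Y Z := C.g_ricOp Y Z
    have h' : S.g.val q ((C.ricOp Y).toField q) (Z.toField q) = (C.ric Y Z).toFun q := by
      rw [← h]
      exact (congrFun (S.g.toFun_onFields (C.ricOp Y) Z) q).symm
    rw [← S.ricci_eq hg hS hW hWp hq, hZ] at h'
    simp [map_sub, val_ricciOperator_basis, h']
  exact LinearMap.congr_fun hlin w

end AlmostContactBMetric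

end CurvatureAtPoint

section RicciOperator

variable {E : Type*} [NormedAddCommGroup E] [NormedSpace ℝ E]
  {H : Type*} [TopologicalSpace H] {I : ModelWithCorners ℝ E H}
  {M : Type*} [TopologicalSpace M] [ChartedSpace H M] [IsManifold I ∞ M]

/-! ### The covariant derivative of the Ricci operator -/

/-- The Leibniz rule for a finite combination of sections with variable coefficients. -/
lemma CovariantDerivative.nabla_sum_smul
    (nabla : CovariantDerivative I E (fun p : M ↦ TangentSpace I p)) {ι : Type*} (s : Finset ι)
    {p : M} {c : ι → M → ℝ} {F : ι → ∀ q : M, TangentSpace I q} (hc : ∀ i, MDiffAt (c i) p)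
    (hF : ∀ i, MDiffAt (T% (F i)) p) :
    MDiffAt (T% (∑ i ∈ s, c i • F i)) p ∧ ∀ x, nabla (∑ i ∈ s, c i • F i) p x =
      ∑ i ∈ s, (c i p • nabla (F i) p x + mvfderiv I (c i) p x • F i p) := by
  classical
  have hcF (i : ι) : MDiffAt (T% (c i • F i)) p := (hc i).smul_section (hF i)
  induction s using Finset.induction_on with
  | empty =>
    rw [Finset.sum_empty]
    exact ⟨mdifferentiableAt_zeroSection ℝ (fun q : M ↦ TangentSpace I q), fun x ↦ by
      rw [nabla.isCovariantDerivativeOnUniv.zero]; simp⟩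
  | insert i s hi h =>
    rw [Finset.sum_insert hi]
    refine ⟨mdifferentiableAt_add_section (hcF i) h.1, fun x ↦ ?_⟩
    rw [nabla.isCovariantDerivativeOnUniv.add (hcF i) h.1, Finset.sum_insert hi, ← h.2,
      nabla.isCovariantDerivativeOnUniv.leibniz (hF i) (hc i)]
    simp

namespace AlmostContactBMetric

open SmoothField SmoothFun

variable [FiniteDimensional ℝ E] {nabla : CovariantDerivative I E (fun p : M ↦ TangentSpace I p)}
  {n : ℕ} (S : AlmostContactBMetric I M n)
  (hg : S.g.IsLeviCivita nabla) (hS : S.IsSasakiLike nabla)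

include hg hS in
/-- The Ricci operator at a point is linear, being an evaluation of an operator on vector fields. -/
lemma exists_linearMap_ricciOperator (q : M) :
    ∃ L : TangentSpace I q →ₗ[ℝ] TangentSpace I q, ∀ x, ricciOperator S.g nabla q x = L x := by
  let e := trivializationAt E (TangentSpace I : M → Type _) q
  have hW : IsOpen e.baseSet := e.open_baseSet
  have hq : q ∈ e.baseSet := mem_baseSet_trivializationAt' q
  have hQ := S.ricciOperator_eq hg hS hW (p := q) subset_rfl hq
  refine ⟨{ toFun := ricciOperator S.g nabla q, map_add' := fun x y ↦ ?_,
            map_smul' := fun r x ↦ ?_ }, fun _ ↦ rfl⟩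
  · obtain ⟨X, rfl⟩ := exists_toField_eq hW subset_rfl hq x
    obtain ⟨Y, rfl⟩ := exists_toField_eq hW subset_rfl hq y
    rw [← Pi.add_apply, ← toField_add, hQ, hQ, hQ, map_add, toField_add, Pi.add_apply]
  · obtain ⟨X, rfl⟩ := exists_toField_eq hW subset_rfl hq x
    let f : SmoothFun I e.baseSet :=
      SmoothFun.restrict e.baseSet (fun _ ↦ r) (contMDiffOn_const (I := I))
    have hf : f.toFun q = r := SmoothFun.toFun_restrict _ hq
    have hsmul (U : SmoothField I e.baseSet) : r • U.toField q = (f • U).toField q := by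
      rw [toField_smul, Pi.smul_apply', hf]
    rw [RingHom.id_apply, hsmul, hQ, hQ, map_smul, hsmul]

include hg hS in
/-- `(∇_x Q)ξ = Qφx - (dim M - 1)φx`. -/
theorem covDerivEndo_ricciOperator_ξ (p : M) (x : TangentSpace I p) :
    covDerivEndo nabla (ricciOperator S.g nabla) S.ξ p x =
      ricciOperator S.g nabla p (S.φ p x) - (Module.finrank ℝ E - 1 : ℝ) • S.φ p x := by
  let e := trivializationAt E (TangentSpace I : M → Type _) p
  have hW : IsOpen e.baseSet := e.open_baseSet
  have hp : p ∈ e.baseSet := mem_baseSet_trivializationAt' p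
  let B := frame (W := e.baseSet) (p := p) (Module.finBasis ℝ E) hW subset_rfl
  have : Module.Free (SmoothFun I e.baseSet) (SmoothField I e.baseSet) := .of_basis B
  have : Module.Finite (SmoothFun I e.baseSet) (SmoothField I e.baseSet) := .of_basis B
  have : Nontrivial (SmoothFun I e.baseSet) := (eval ⟨p, hp⟩).domain_nontrivial
  have hrank : Module.finrank (SmoothFun I e.baseSet) (SmoothField I e.baseSet) =
      Module.finrank ℝ E := by simpa using Module.finrank_eq_card_basis B
  let C := S.localAlgebra hg hS hW (p := p) subset_rfl
  have hQ {q : M} (hq : q ∈ e.baseSet) (Y : SmoothField I e.baseSet) :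
      ricciOperator S.g nabla q (Y.toField q) = (C.ricOp Y).toField q :=
    S.ricciOperator_eq hg hS hW subset_rfl hq Y
  have hξ {q : M} (hq : q ∈ e.baseSet) : S.ξ q = C.ξ.toField q := (S.toField_ξField hq).symm
  have hcov (X Y : SmoothField I e.baseSet) (q : M) :
      nabla Y.toField q (X.toField q) = (C.cov X Y).toField q :=
    (hg.toField_cov_apply hW X Y q).symm
  obtain ⟨X, rfl⟩ := exists_toField_eq hW subset_rfl hp x
  have hφ : S.φ p (X.toField p) = (C.φ X).toField p :=
    (congrFun (toField_applyEndo S.contMDiff_φ X) p).symm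
  have hzsmul (k : ℤ) (Y : SmoothField I e.baseSet) : (k • Y).toField p = k • Y.toField p :=
    map_zsmul (evalHom p) k Y
  have h := congrArg (fun Y ↦ Y.toField p) (C.cov_ricOp_ξ X)
  simp only [toField_sub, Pi.sub_apply, hzsmul, hrank] at h
  have h₁ : nabla S.ξ p = nabla C.ξ.toField p :=
    nabla.congr_of_eventuallyEq (C.ξ.mdiffAt_toField hW hp) <| by
      filter_upwards [hW.mem_nhds hp] with q hq using hξ hq
  have h₂ : nabla (fun q ↦ ricciOperator S.g nabla q (S.ξ q)) p =
      nabla (C.ricOp C.ξ).toField p :=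
    nabla.congr_of_eventuallyEq ((C.ricOp C.ξ).mdiffAt_toField hW hp) <| by
      filter_upwards [hW.mem_nhds hp] with q hq
      rw [hξ hq, hQ hq]
  rw [covDerivEndo, h₁, h₂, hcov, hcov, hQ hp, hφ, hQ hp, h, ← Int.cast_smul_eq_zsmul ℝ]
  simp

include hg hS in
/-- `(∇_ξ Q)Y = 2QφY`. The field `Y` is only required to be differentiable at `p`, so it is
expanded in a smooth local frame. -/
theorem covDerivEndo_ricciOperator_apply_ξ (p : M) {Y : ∀ q : M, TangentSpace I q}
    (hY : MDiffAt (T% Y) p) :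
    covDerivEndo nabla (ricciOperator S.g nabla) Y p (S.ξ p) =
      (2 : ℝ) • ricciOperator S.g nabla p (S.φ p (Y p)) := by
  let e := trivializationAt E (TangentSpace I : M → Type _) p
  have hW : IsOpen e.baseSet := e.open_baseSet
  have hp : p ∈ e.baseSet := mem_baseSet_trivializationAt' p
  let b := Module.finBasis ℝ E
  let B := frame (W := e.baseSet) (p := p) b hW subset_rfl
  have : Module.Free (SmoothFun I e.baseSet) (SmoothField I e.baseSet) := .of_basis B
  have : Module.Finite (SmoothFun I e.baseSet) (SmoothField I e.baseSet) := .of_basis B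
  let C := S.localAlgebra hg hS hW (p := p) subset_rfl
  choose L hL using S.exists_linearMap_ricciOperator hg hS
  have hQ {q : M} (hq : q ∈ e.baseSet) (Y : SmoothField I e.baseSet) :
      L q (Y.toField q) = (C.ricOp Y).toField q := by
    rw [← hL]
    exact S.ricciOperator_eq hg hS hW subset_rfl hq Y
  have hcov (Y : SmoothField I e.baseSet) :
      nabla Y.toField p (S.ξ p) = (C.cov C.ξ Y).toField p := by
    rw [← S.toField_ξField hp]
    exact (hg.toField_cov_apply hW C.ξ Y p).symm
  let c (i) (q : M) : ℝ := e.localFrameCoeff I b i q (Y q)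
  have hc (i) : MDiffAt (c i) p := mdifferentiableAt_localFrameCoeff b hp hY i
  have hYB {q : M} (hq : q ∈ e.baseSet) : Y q = (∑ i, c i • (B i).toField) q := by
    rw [Finset.sum_apply]
    refine (e.eq_sum_localFrameCoeff_smul (I := I) (b := b) hq).trans
      (Finset.sum_congr rfl fun i _ ↦ ?_)
    rw [Pi.smul_apply', toField_frame b hW subset_rfl i hq, e.localFrame_apply_of_mem_baseSet b hq]
    rfl
  have hQY {q : M} (hq : q ∈ e.baseSet) :
      ricciOperator S.g nabla q (Y q) = (∑ i, c i • (C.ricOp (B i)).toField) q := by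
    rw [hL, hYB hq]
    simp only [Finset.sum_apply, Pi.smul_apply', map_sum, map_smul, hQ hq]
  have h₁ := nabla.nabla_sum_smul Finset.univ hc fun i ↦ (B i).mdiffAt_toField hW hp
  have h₂ := nabla.nabla_sum_smul Finset.univ hc fun i ↦ (C.ricOp (B i)).mdiffAt_toField hW hp
  have h₃ : nabla Y p = nabla (∑ i, c i • (B i).toField) p :=
    nabla.congr_of_eventuallyEq h₁.1 <| by
      filter_upwards [hW.mem_nhds hp] with q hq using hYB hq
  have h₄ : nabla (fun q ↦ ricciOperator S.g nabla q (Y q)) p =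
      nabla (∑ i, c i • (C.ricOp (B i)).toField) p :=
    nabla.congr_of_eventuallyEq h₂.1 <| by
      filter_upwards [hW.mem_nhds hp] with q hq using hQY hq
  rw [covDerivEndo, h₃, h₄, h₁.2, h₂.2, hL, hL, hYB hp]
  simp only [Finset.sum_apply, Pi.smul_apply', map_sum, map_smul, map_add, hcov, hQ hp,
    ← Finset.sum_sub_distrib, Finset.smul_sum]
  refine Finset.sum_congr rfl fun i _ ↦ ?_
  have h := congrArg (fun Y ↦ Y.toField p)
    (C.cov_ξ_ricOp (S.trace_φ_localAlgebra hg hS hW subset_rfl) (B i))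
  have htwo : (2 : SmoothFun I e.baseSet).toFun p = 2 := by rw [toFun_of_mem _ hp, map_ofNat]
  have hφ : S.φ p ((B i).toField p) = (C.φ (B i)).toField p :=
    (congrFun (toField_applyEndo S.contMDiff_φ (B i)) p).symm
  simp only [toField_sub, Pi.sub_apply, toField_smul, Pi.smul_apply', htwo] at h
  rw [hφ, hQ hp]
  linear_combination (norm := module) c i p • h

end AlmostContactBMetric

end RicciOperator

theorem proposition1p1 (n : ℕ) {M : Type*} [TopologicalSpace M]
    [ChartedSpace (EuclideanSpace ℝ (Fin (2 * n + 1))) M] [IsManifold (𝓡 (2 * n + 1)) ∞ M]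
    (S : AlmostContactBMetric (𝓡 (2 * n + 1)) M n)
    (nabla : CovariantDerivative (𝓡 (2 * n + 1)) (EuclideanSpace ℝ (Fin (2 * n + 1)))
      (fun p : M ↦ TangentSpace (𝓡 (2 * n + 1)) p))
    (hnabla : S.g.IsLeviCivita nabla) (hS : S.IsSasakiLike nabla) :
    (∀ (p : M) (x : TangentSpace (𝓡 (2 * n + 1)) p),
      covDerivEndo nabla (ricciOperator S.g nabla) S.ξ p x =
        ricciOperator S.g nabla p (S.φ p x) - (2 * n : ℝ) • S.φ p x) ∧
    (∀ (p : M) (Y : ∀ q : M, TangentSpace (𝓡 (2 * n + 1)) q), SmoothVectorFieldAt Y p →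
      covDerivEndo nabla (ricciOperator S.g nabla) Y p (S.ξ p) =
        (2 : ℝ) • ricciOperator S.g nabla p (S.φ p (Y p))) := by
  refine ⟨fun p x ↦ ?_, fun p Y hY ↦ S.covDerivEndo_ricciOperator_apply_ξ hnabla hS p
    (hY.mdifferentiableAt (by simp))⟩
  simpa using S.covDerivEndo_ricciOperator_ξ hnabla hS p x
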